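/- Let $\Gamma$ be a countable group and let $C$ be a space homeomorphic to the Cantor set. Let $\Gamma$ act on $C^\Gamma$ by $(\gamma x)(f)=x(\gamma^{-1}f)$, and let $\mathrm{Prob}_\Gamma(C^\Gamma)$ be the set of $\Gamma$-invariant Borel probability measures on $C^\Gamma$ with the weak* topology, viewed as a subset of the (locally convex, weak*) dual of the space of continuous real functions on $C^\Gamma$. Let $\mathbf a=\Gamma\curvearrowright(X,\mu)$ be a probability-measure-preserving (pmp) action on a standard probability space. Let $\mathrm{Factor}(\mathbf a)$ be the set of measures $\Phi_*\mu$ with $\Phi:X\to C^\Gamma$ measurable and $\Gamma$-equivariant, let $W(\mathbf a)$ be its weak* closure, and let $SW(\mathbf a)=W(\mathbf a\times\mathbf i)$, where $\mathbf i$ is the trivial action of $\Gamma$ on $[0,1]$ with Lebesgue measure. The action $\mathbf a$ is strongly ergodic if there is no sequence of measurable sets $B_i\subseteq X$ with $\lim_i\mu(B_i\,\triangle\,\gamma B_i)=0$ for every $\gamma\in\Gamma$ and $\limsup_i\mu(B_i)(1-\mu(B_i))>0$. A Choquet simplex is a nonempty compact convex subset $K$ of a locally convex Hausdorff real topological vector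 space such that every $x\in K$ is the barycenter of a unique Borel probability measure on the set of extreme points of $K$. It is a Bauer simplex if its set of extreme points is closed, and a Poulsen simplex if it is metrizable, has more than one point, and its extreme points are dense in it. Theorem. 1. If $\mathbf a$ is ergodic, then $SW(\mathbf a)$ is a subsimplex of $\mathrm{Prob}_\Gamma(C^\Gamma)$: it is a Choquet simplex which is a closed convex subset of $\mathrm{Prob}_\Gamma(C^\Gamma)$, and its extreme points are extreme points of $\mathrm{Prob}_\Gamma(C^\Gamma)$. 2. The action $\mathbf a$ is strongly ergodic if and only if $W(\mathbf a)$ is the set of extreme points of $SW(\mathbf a)$, and in this case $SW(\mathbf a)$ is a Bauer simplex. 3. If $\mathbf a$ is ergodic but not strongly ergodic, then $SW(\mathbf a)=W(\mathbf a)$, and this set is a Poulsen simplex. -/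

import Mathlib

open MeasureTheory Topology Filter Set
open scoped BoundedContinuousFunction

section Simplices

variable {E : Type*} [AddCommGroup E] [Module ℝ E] [TopologicalSpace E]

/-- The measure `m` on the set of extreme points of `K` (with its Borel σ-algebra) is a
probability measure with barycenter `x`, i.e. `x = ∫ e dm(e)` in the weak sense. -/
def RepresentsOnExtremePoints (K : Set E) (x : E)
    (m : @Measure (K.extremePoints ℝ) (borel (K.extremePoints ℝ))) : Prop :=
  letI : MeasurableSpace (K.extremePoints ℝ) := borel (K.extremePoints ℝ)
  IsProbabilityMeasure m ∧ ∀ f : E →L[ℝ] ℝ, ∫ e, f (e : E) ∂m = f x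

/-- A (nonempty) Choquet simplex: a compact convex subset of a locally convex space, each of
whose points is a convex integral of extreme points in a unique way. -/
def IsChoquetSimplex [IsTopologicalAddGroup E] [ContinuousSMul ℝ E] [LocallyConvexSpace ℝ E]
    [T2Space E] (K : Set E) : Prop :=
  K.Nonempty ∧ IsCompact K ∧ Convex ℝ K ∧ ∀ x ∈ K, ∃! m, RepresentsOnExtremePoints K x m

variable [IsTopologicalAddGroup E] [ContinuousSMul ℝ E] [LocallyConvexSpace ℝ E] [T2Space E]

/-- A subsimplex of `S`: a simplex `K ⊆ S` that is a closed convex set whose extreme points are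
extreme points of `S`. -/
def IsSubsimplex (K S : Set E) : Prop :=
  K ⊆ S ∧ IsClosed K ∧ Convex ℝ K ∧ K.extremePoints ℝ ⊆ S.extremePoints ℝ ∧ IsChoquetSimplex K

/-- A Bauer simplex: the set of extreme points is closed. -/
def IsBauerSimplex (K : Set E) : Prop :=
  IsChoquetSimplex K ∧ IsClosed (K.extremePoints ℝ)

/-- A Poulsen simplex: a metrizable Choquet simplex with more than one point, whose extreme
points are dense. -/
def IsPoulsenSimplex (K : Set E) : Prop :=
  IsChoquetSimplex K ∧ TopologicalSpace.MetrizableSpace K ∧ K.Nontrivial ∧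
    K ⊆ closure (K.extremePoints ℝ)

end Simplices

section WeakStar

instance weakDualLocallyConvexSpace {F : Type*} [AddCommGroup F] [Module ℝ F]
    [TopologicalSpace F] : LocallyConvexSpace ℝ (WeakDual ℝ F) :=
  inferInstanceAs (LocallyConvexSpace ℝ (WeakBilin (topDualPairing ℝ F)))

variable {Ω : Type*} [TopologicalSpace Ω] [MeasurableSpace Ω] [OpensMeasurableSpace Ω]

/-- A probability measure `μ`, seen as the functional `f ↦ ∫ f dμ` in the dual of the space of
bounded continuous functions, with the weak-* topology. This realizes spaces of probability
measures as subsets of a locally convex space. -/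
noncomputable def toDual (μ : ProbabilityMeasure Ω) : WeakDual ℝ (Ω →ᵇ ℝ) :=
  StrongDual.toWeakDual <| LinearMap.mkContinuous
    { toFun := fun f : Ω →ᵇ ℝ => ∫ x, f x ∂(μ : Measure Ω)
      map_add' := fun f g => integral_add (f.integrable _) (g.integrable _)
      map_smul' := fun c f => integral_const_mul c f }
    1 (fun f => by simpa using f.norm_integral_le_norm (μ := (μ : Measure Ω)))

theorem toDual_apply (μ : ProbabilityMeasure Ω) (f : Ω →ᵇ ℝ) :
    toDual μ f = ∫ x, f x ∂(μ : Measure Ω) := rfl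

end WeakStar

section Actions

/-- The shift action of `Γ` on `C^Γ`, `(γ x)(f) = x (γ⁻¹ f)`. -/
def shift {Γ C : Type*} [Group Γ] (γ : Γ) (x : Γ → C) : Γ → C := fun f => x (γ⁻¹ * f)

variable (Γ : Type*) [Group Γ] [Countable Γ] (C : Type*) [TopologicalSpace C]
  [SecondCountableTopology C] [MeasurableSpace C] [BorelSpace C]

/-- `Prob_Γ(C^Γ)`: the shift-invariant Borel probability measures on `C^Γ`. -/
def invariantProb : Set (ProbabilityMeasure (Γ → C)) :=
  {ν | ∀ γ : Γ, (ν : Measure (Γ → C)).map (shift γ) = ν}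

variable {X : Type*} [MeasurableSpace X]

/-- `Factor(a)`: all measures `Φ_* μ`, with `Φ : X → C^Γ` measurable and equivariant. -/
def factorMeasures [SMul Γ X] (μ : Measure X) : Set (ProbabilityMeasure (Γ → C)) :=
  {ν | ∃ Φ : X → Γ → C, Measurable Φ ∧ (∀ (γ : Γ) (x : X), Φ (γ • x) = shift γ (Φ x)) ∧
    (ν : Measure (Γ → C)) = μ.map Φ}

/-- `W(a)`: the weak-* closure of `Factor(a)`. -/
def weakClass [SMul Γ X] (μ : Measure X) : Set (ProbabilityMeasure (Γ → C)) :=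
  closure (factorMeasures Γ C μ)

/-- `SW(a) = W(a × i)`, with `i` the trivial action of `Γ` on the unit interval with Lebesgue
measure. -/
noncomputable def stableWeakClass [SMul Γ X] (μ : Measure X) :
    Set (ProbabilityMeasure (Γ → C)) :=
  letI : SMul Γ unitInterval := ⟨fun _ t => t⟩
  weakClass Γ C (μ.prod (volume : Measure unitInterval))

/-- The measurable sets `B i` are asymptotically invariant: `μ (B i ∆ γ B i) → 0` for all `γ`. -/
def IsAsymptoticallyInvariant [SMul Γ X] (μ : Measure X) (B : ℕ → Set X) : Prop :=
  (∀ i, MeasurableSet (B i)) ∧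
    ∀ γ : Γ, Tendsto (fun i => μ.real (symmDiff (B i) ((fun x => γ • x) '' B i))) atTop (𝓝 0)

/-- The action is strongly ergodic: it has no asymptotically invariant sequence `B` that is
nontrivial, i.e. such that `limsup μ (B i) (1 - μ (B i)) > 0`. -/
def IsStronglyErgodic [SMul Γ X] (μ : Measure X) : Prop :=
  ¬ ∃ B : ℕ → Set X, IsAsymptoticallyInvariant Γ μ B ∧
    0 < limsup (fun i => μ.real (B i) * (1 - μ.real (B i))) atTop

end Actions

/-!
Throughout, measures on `Ω = Γ → C` are compared with functionals through `toDual`, a closed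
embedding, and ergodicity is detected by averages: with strictly positive weights on `Γ` and the
corresponding Markov operator `T`, the Cesàro averages `avgFun Γ n f` of a continuous function `f`
converge in `L²(e)` for every invariant measure `e`, by the mean ergodic theorem, and to a constant
if `e` is ergodic. As the averages do not depend on `e`, this makes ergodic measures extreme points
(`mem_extremePoints_of_tendsto`). It also gives the uniqueness of the ergodic decomposition
(`eq_of_isBarycenter_of_ergodic`): a product of functions `e ↦ ∫ f de` agrees on ergodic measures
with the limit of the integrals of products of averages, so its integral over a measure on ergodic
measures is determined by the barycenter, and the Stone–Weierstrass theorem applies. Hence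
a compact convex set of invariant measures is a simplex, whose extreme points are extreme among all
invariant measures, as soon as its extreme points are ergodic and represent all its points
(`isSubsimplex_toDual`).

The dynamical input is about asymptotically invariant sets `B k ⊆ X`. In an ergodic action their
indicator functions converge weakly to constants, so gluing maps `φ k` on `B k` with a fixed map
off `B k` produces factors which converge to convex combinations
(`smul_add_smul_mem_of_isAsymptoticallyInvariant`). If the action is ergodic and not strongly
ergodic, nontrivial `B k` exist and `weakClass` is convex. Conversely an invariant set `A` of a weak
limit `x` of factors is approximated by clopen sets and pulls back to asymptotically invariant sets
in `X` (`exists_isAsymptoticallyInvariant_of_mem_weakClass`). Thus weak limits of factors of strongly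
ergodic actions are ergodic. For ergodic actions the gluing construction, applied repeatedly,
shows that the conditional measure of `x` on `A` is again a weak limit of factors
(`cond_mem_weakClass`); this yields the ergodic decomposition of `x` inside `weakClass` when that set
is convex (`exists_ergodic_decomposition`), and the ergodicity of its extreme points.

Finally, a factor of `X × [0,1]` is a mixture of factors of `X`, and mixtures of two factors of
`X × [0,1]` are again such factors, so `stableWeakClass` is convex and each of its points is the
barycenter of a measure on `weakClass` (`exists_isBarycenter_of_mem_stableWeakClass`). In the
strongly ergodic case Milman's converse of the Krein–Milman theorem (`mem_of_mem_extremePoints`)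
identifies its extreme points with `weakClass`, which is closed; if `weakClass` is convex, it equals
`stableWeakClass`, and factors are ergodic, so extreme points are dense.
-/

/-! ### Weighted averages of contractions -/

section Averages

variable {ι V V' : Type*} [NormedAddCommGroup V] [NormedSpace ℝ V]
  [NormedAddCommGroup V'] [NormedSpace ℝ V']

theorem exists_pos_hasSum_one (ι : Type*) [Countable ι] [Nonempty ι] :
    ∃ p : ι → ℝ, (∀ i, 0 < p i) ∧ HasSum p 1 := by
  have : Encodable ι := Encodable.ofCountable ι
  obtain ⟨p, hp, c, hc, -⟩ := posSumOfEncodable (one_pos (α := ℝ)) ι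
  have hc0 : 0 < c := by
    obtain ⟨i⟩ := ‹Nonempty ι›
    exact (hp i).trans_le (le_hasSum hc i fun j _ => (hp j).le)
  refine ⟨fun i => p i / c, fun i => div_pos (hp i) hc0, ?_⟩
  simpa [hc0.ne'] using hc.div_const c

/-- A choice of strictly positive weights of total mass one on a countable nonempty type. -/
noncomputable def unitWeight (ι : Type*) [Countable ι] [Nonempty ι] : ι → ℝ :=
  (exists_pos_hasSum_one ι).choose

variable [Countable ι] [Nonempty ι]

theorem unitWeight_pos (i : ι) : 0 < unitWeight ι i := (exists_pos_hasSum_one ι).choose_spec.1 i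

theorem hasSum_unitWeight : HasSum (unitWeight ι) 1 := (exists_pos_hasSum_one ι).choose_spec.2

/-- The average of the operators `U i` with respect to the weights `unitWeight`. -/
noncomputable def weightedOp (U : ι → V →L[ℝ] V) : V →L[ℝ] V := ∑' i, unitWeight ι i • U i

/-- The Cesàro averages `(1 + T + ⋯ + T ^ n) / (n + 1)` of `T = weightedOp U`. -/
noncomputable def avgOp (U : ι → V →L[ℝ] V) (n : ℕ) : V →L[ℝ] V :=
  ((n + 1 : ℕ) : ℝ)⁻¹ • ∑ k ∈ Finset.range (n + 1), weightedOp U ^ k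

theorem norm_unitWeight_smul_le {U : ι → V →L[ℝ] V} (hU : ∀ i, ‖U i‖ ≤ 1) (i : ι) :
    ‖unitWeight ι i • U i‖ ≤ unitWeight ι i := by
  rw [norm_smul, Real.norm_of_nonneg (unitWeight_pos i).le]
  exact mul_le_of_le_one_right (unitWeight_pos i).le (hU i)

theorem avgOp_apply (U : ι → V →L[ℝ] V) (n : ℕ) (v : V) :
    avgOp U n v = ((n + 1 : ℕ) : ℝ)⁻¹ • ∑ k ∈ Finset.range (n + 1), (weightedOp U ^ k) v := by
  simp [avgOp]

theorem avgOp_apply_eq_birkhoffAverage (U : ι → V →L[ℝ] V) (n : ℕ) (v : V) :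
    avgOp U n v = birkhoffAverage ℝ (weightedOp U) _root_.id (n + 1) v := by
  simp [avgOp_apply, birkhoffAverage, birkhoffSum]

theorem norm_weightedOp_le {U : ι → V →L[ℝ] V} (hU : ∀ i, ‖U i‖ ≤ 1) : ‖weightedOp U‖ ≤ 1 :=
  tsum_of_norm_bounded hasSum_unitWeight (norm_unitWeight_smul_le hU)

theorem norm_avgOp_le {U : ι → V →L[ℝ] V} (hU : ∀ i, ‖U i‖ ≤ 1) (n : ℕ) : ‖avgOp U n‖ ≤ 1 := by
  have hpos : (0 : ℝ) < ((n + 1 : ℕ) : ℝ) := by positivity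
  rw [avgOp, norm_smul, norm_inv, Real.norm_of_nonneg hpos.le, inv_mul_le_iff₀ hpos, mul_one]
  refine (norm_sum_le _ _).trans ?_
  refine (Finset.sum_le_card_nsmul _ _ 1 fun k _ => ?_).trans (by simp)
  rcases Nat.eq_zero_or_pos k with rfl | hk
  · rw [pow_zero]
    exact ContinuousLinearMap.norm_id_le
  · exact (norm_pow_le' _ hk).trans (pow_le_one₀ (norm_nonneg _) (norm_weightedOp_le hU))

theorem avgOp_id (n : ℕ) (v : V) :
    avgOp (fun _ : ι => ContinuousLinearMap.id ℝ V) n v = v := by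
  have h1 : weightedOp (fun _ : ι => ContinuousLinearMap.id ℝ V) = 1 := by
    have := (hasSum_unitWeight (ι := ι)).smul_const (ContinuousLinearMap.id ℝ V)
    rw [one_smul] at this
    exact this.tsum_eq
  have hpos : ((n : ℝ) + 1) ≠ 0 := by positivity
  rw [avgOp_apply, h1]
  simp [← Nat.cast_smul_eq_nsmul ℝ, smul_smul, inv_mul_cancel₀ hpos]

variable [CompleteSpace V] [CompleteSpace V']

theorem hasSum_weightedOp {U : ι → V →L[ℝ] V} (hU : ∀ i, ‖U i‖ ≤ 1) :
    HasSum (fun i => unitWeight ι i • U i) (weightedOp U) :=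
  (Summable.of_norm_bounded hasSum_unitWeight.summable (norm_unitWeight_smul_le hU)).hasSum

theorem hasSum_weightedOp_apply {U : ι → V →L[ℝ] V} (hU : ∀ i, ‖U i‖ ≤ 1) (v : V) :
    HasSum (fun i => unitWeight ι i • U i v) (weightedOp U v) := by
  simpa using (hasSum_weightedOp hU).mapL (ContinuousLinearMap.apply ℝ V v)

theorem weightedOp_comm {U : ι → V →L[ℝ] V} {U' : ι → V' →L[ℝ] V'} (hU : ∀ i, ‖U i‖ ≤ 1)
    (hU' : ∀ i, ‖U' i‖ ≤ 1) (J : V →L[ℝ] V') (h : ∀ i v, J (U i v) = U' i (J v)) (v : V) :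
    J (weightedOp U v) = weightedOp U' (J v) := by
  refine HasSum.unique ((hasSum_weightedOp_apply hU v).mapL J) ?_
  simpa [h] using hasSum_weightedOp_apply hU' (J v)

theorem weightedOp_pow_comm {U : ι → V →L[ℝ] V} {U' : ι → V' →L[ℝ] V'} (hU : ∀ i, ‖U i‖ ≤ 1)
    (hU' : ∀ i, ‖U' i‖ ≤ 1) (J : V →L[ℝ] V') (h : ∀ i v, J (U i v) = U' i (J v)) (k : ℕ) (v : V) :
    J ((weightedOp U ^ k) v) = (weightedOp U' ^ k) (J v) := by
  induction k generalizing v with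
  | zero => simp
  | succ k ih =>
    rw [pow_succ, pow_succ, mul_apply_eq_comp, mul_apply_eq_comp, ih,
      weightedOp_comm hU hU' J h]

theorem avgOp_comm {U : ι → V →L[ℝ] V} {U' : ι → V' →L[ℝ] V'} (hU : ∀ i, ‖U i‖ ≤ 1)
    (hU' : ∀ i, ‖U' i‖ ≤ 1) (J : V →L[ℝ] V') (h : ∀ i v, J (U i v) = U' i (J v)) (n : ℕ) (v : V) :
    J (avgOp U n v) = avgOp U' n (J v) := by
  simp only [avgOp_apply, map_smul, map_sum, weightedOp_pow_comm hU hU' J h]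

end Averages

section MeanErgodic

variable {ι H : Type*} [Countable ι] [Nonempty ι] [NormedAddCommGroup H] [InnerProductSpace ℝ H]
  [CompleteSpace H]

/-- By strict convexity, a vector fixed by an average of contractions is fixed by each of them. -/
theorem eq_of_weightedOp_eq {U : ι → H →L[ℝ] H} (hU : ∀ i, ‖U i‖ ≤ 1) {w : H}
    (hw : weightedOp U w = w) (i : ι) : U i w = w := by
  have hn : ∀ i, ‖U i w‖ ≤ ‖w‖ := fun i => by simpa using (U i).le_of_opNorm_le (hU i) w
  have h1 : HasSum (fun i => unitWeight ι i * inner ℝ (U i w) w) (‖w‖ ^ 2) := by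
    have := (hasSum_weightedOp_apply hU w).mapL (innerSL ℝ w)
    rw [hw] at this
    simpa [real_inner_self_eq_norm_sq, real_inner_comm, inner_smul_left] using this
  have h2 : HasSum (fun i => unitWeight ι i * (‖w‖ ^ 2 - inner ℝ (U i w) w)) 0 := by
    have := ((hasSum_unitWeight (ι := ι)).mul_right (‖w‖ ^ 2)).sub h1
    simpa [mul_sub] using this
  have hle : ∀ i, inner ℝ (U i w) w ≤ ‖w‖ ^ 2 := fun i => by
    have := real_inner_le_norm (U i w) w
    nlinarith [hn i, norm_nonneg w]
  have h3 := (hasSum_zero_iff_of_nonneg fun i =>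
    mul_nonneg (unitWeight_pos i).le (sub_nonneg.2 (hle i))).1 h2
  have h4 := congrFun h3 i
  simp only [Pi.zero_apply, mul_eq_zero, (unitWeight_pos i).ne', false_or] at h4
  refine eq_of_norm_le_re_inner_eq_norm_sq (𝕜 := ℝ) (hn i) ?_
  simp only [RCLike.re_to_real]
  linarith

/-- The averages of a countable family of contractions of a Hilbert space converge to
common fixed vectors. -/
theorem exists_tendsto_avgOp {U : ι → H →L[ℝ] H} (hU : ∀ i, ‖U i‖ ≤ 1) (v : H) :
    ∃ w, (∀ i, U i w = w) ∧ Tendsto (fun n => avgOp U n v) atTop (𝓝 w) := by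
  have h := (weightedOp U).tendsto_birkhoffAverage_orthogonalProjection (norm_weightedOp_le hU) v
  obtain ⟨w, hw⟩ : ∃ w : (weightedOp U : H →ₗ[ℝ] H).eqLocus ((1 : H →L[ℝ] H) : H →ₗ[ℝ] H),
    Tendsto (birkhoffAverage ℝ (weightedOp U) _root_.id · v) atTop (𝓝 (w : H)) := ⟨_, h⟩
  simp only [avgOp_apply_eq_birkhoffAverage]
  exact ⟨w, fun i => eq_of_weightedOp_eq hU w.2 i, hw.comp (tendsto_add_atTop_nat 1)⟩

end MeanErgodic

/-! ### The Koopman representation -/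

section Koopman

variable {Γ Y : Type*} [Group Γ] [MeasurableSpace Y] [MulAction Γ Y] [MeasurableConstSMul Γ Y]
  (ν : Measure Y) [SMulInvariantMeasure Γ Y ν]

/-- The Koopman operator `f ↦ f (γ • ·)` on `L²(ν)`. -/
noncomputable def koopman (γ : Γ) : Lp ℝ 2 ν →L[ℝ] Lp ℝ 2 ν :=
  (Lp.compMeasurePreservingₗᵢ ℝ (γ • ·) (measurePreserving_smul γ ν)).toContinuousLinearMap

theorem koopman_ae_eq (γ : Γ) (f : Lp ℝ 2 ν) : koopman ν γ f =ᵐ[ν] fun y => f (γ • y) :=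
  Lp.coeFn_compMeasurePreserving f (measurePreserving_smul γ ν)

theorem norm_koopman_apply (γ : Γ) (f : Lp ℝ 2 ν) : ‖koopman ν γ f‖ = ‖f‖ :=
  (Lp.compMeasurePreservingₗᵢ ℝ (γ • ·) (measurePreserving_smul γ ν)).norm_map f

theorem norm_koopman_le (γ : Γ) : ‖koopman ν γ‖ ≤ 1 :=
  LinearIsometry.norm_toContinuousLinearMap_le _

end Koopman

/-- An a.e. invariant measurable function is a.e. constant if the action is ergodic. -/
theorem ae_eq_const_of_invariant {Γ Y : Type*} [Group Γ] [MeasurableSpace Y] [MulAction Γ Y]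
    {ν : Measure Y} [ErgodicSMul Γ Y ν] {h : Y → ℝ} (hm : AEStronglyMeasurable h ν)
    (hinv : ∀ γ : Γ, (fun y => h (γ • y)) =ᵐ[ν] h) : ∃ c, h =ᵐ[ν] Function.const Y c := by
  refine exists_eventuallyEq_const_of_forall_separating MeasurableSet fun U hU => ?_
  have h1 : EventuallyConst (h ⁻¹' U) (ae ν) := by
    refine aeconst_of_forall_preimage_smul_ae_eq Γ
      (hm.aemeasurable.nullMeasurable hU) fun γ => ?_
    exact (hinv γ).preimage U
  exact eventuallyConst_set.1 h1

/-! ### Averages of continuous functions -/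

section L2

variable {Ω : Type*} [MeasurableSpace Ω] {ν : Measure Ω} [IsProbabilityMeasure ν]

theorem sq_integral_abs_le {g : Ω → ℝ}
    (hg : MemLp g 2 ν) : (∫ x, |g x| ∂ν) ^ 2 ≤ ∫ x, g x ^ 2 ∂ν := by
  have hi : Integrable (fun x => |g x|) ν := (hg.integrable one_le_two).abs
  have h0 : 0 ≤ ∫ x, (|g x| - ∫ y, |g y| ∂ν) ^ 2 ∂ν := integral_nonneg fun x => sq_nonneg _
  set c := ∫ y, |g y| ∂ν with hc
  have h1 : ∫ x, (|g x| - c) ^ 2 ∂ν = ∫ x, (g x ^ 2 - (2 * c * |g x| - c ^ 2)) ∂ν :=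
    integral_congr_ae (ae_of_all _ fun x => by simp only [sub_sq, sq_abs]; ring)
  have hi2 : Integrable (fun x => 2 * c * |g x| - c ^ 2) ν :=
    (hi.const_mul _).sub (integrable_const _)
  rw [h1, integral_sub hg.integrable_sq hi2,
    integral_sub (hi.const_mul _) (integrable_const _), integral_const_mul, ← hc] at h0
  simp only [integral_const, probReal_univ, one_smul] at h0
  nlinarith

theorem sq_integral_le {g : Ω → ℝ}
    (hg : MemLp g 2 ν) : (∫ x, g x ∂ν) ^ 2 ≤ ∫ x, g x ^ 2 ∂ν :=
  (sq_le_sq' (by linarith [neg_abs_le (∫ x, g x ∂ν), abs_integral_le_integral_abs (f := g) (μ := ν)])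
    ((le_abs_self _).trans abs_integral_le_integral_abs)).trans (sq_integral_abs_le hg)

theorem tendsto_integral_abs_of_sq {g : ℕ → Ω → ℝ}
    (hg : ∀ n, MemLp (g n) 2 ν) (h : Tendsto (fun n => ∫ x, g n x ^ 2 ∂ν) atTop (𝓝 0)) :
    Tendsto (fun n => ∫ x, |g n x| ∂ν) atTop (𝓝 0) := by
  have h1 := h.sqrt
  rw [Real.sqrt_zero] at h1
  exact squeeze_zero (fun n => integral_nonneg fun x => abs_nonneg _)
    (fun n => Real.le_sqrt_of_sq_le (sq_integral_abs_le (hg n))) h1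

theorem memLp_boundedContinuous [TopologicalSpace Ω] [BorelSpace Ω] (f : Ω →ᵇ ℝ) :
    MemLp f 2 ν :=
  MemLp.of_bound f.continuous.measurable.aestronglyMeasurable ‖f‖
    (ae_of_all _ f.norm_coe_le_norm)

end L2

section AvgFun

variable (Γ : Type*) {Ω : Type*} [Group Γ] [TopologicalSpace Ω] [MulAction Γ Ω]
  [ContinuousConstSMul Γ Ω]

/-- The operator `f ↦ f (γ • ·)` on bounded continuous functions. -/
noncomputable def translateOp (γ : Γ) : (Ω →ᵇ ℝ) →L[ℝ] (Ω →ᵇ ℝ) :=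
  BoundedContinuousFunction.compContinuousCLM ℝ ℝ ⟨(γ • ·), continuous_const_smul γ⟩

variable {Γ}

@[simp]
theorem translateOp_apply (γ : Γ) (f : Ω →ᵇ ℝ) (x : Ω) : translateOp Γ γ f x = f (γ • x) := rfl

theorem norm_translateOp_le (γ : Γ) : ‖(translateOp Γ γ : (Ω →ᵇ ℝ) →L[ℝ] (Ω →ᵇ ℝ))‖ ≤ 1 :=
  ContinuousLinearMap.opNorm_le_bound _ zero_le_one fun f => by
    rw [one_mul]
    exact f.norm_compContinuous_le _

variable (Γ) [Countable Γ]

/-- A sequence of averages of the translates of `f` along `Γ`, which does not depend on a measure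
and converges in `L²(ν)` to an invariant function, for every invariant `ν`. -/
noncomputable def avgFun (n : ℕ) : (Ω →ᵇ ℝ) →L[ℝ] (Ω →ᵇ ℝ) :=
  avgOp (translateOp Γ) n

theorem norm_avgFun_apply_le (n : ℕ) (f : Ω →ᵇ ℝ) : ‖avgFun Γ n f‖ ≤ ‖f‖ := by
  simpa using (avgFun Γ n).le_of_opNorm_le (norm_avgOp_le norm_translateOp_le n) f

theorem avgFun_one (n : ℕ) : avgFun Γ n (1 : Ω →ᵇ ℝ) = 1 := by
  have h := avgOp_comm (ι := Γ) (U := fun _ => ContinuousLinearMap.id ℝ ℝ)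
    (U' := translateOp Γ) (fun _ => ContinuousLinearMap.norm_id_le) norm_translateOp_le
    ((ContinuousLinearMap.id ℝ ℝ).smulRight (1 : Ω →ᵇ ℝ)) (fun γ v => by ext x; simp) n 1
  rw [avgOp_id] at h
  simpa [avgFun] using h.symm

theorem avgFun_nonneg (n : ℕ) {f : Ω →ᵇ ℝ} (hf : 0 ≤ f) : 0 ≤ avgFun Γ n f := by
  have hT : ∀ g : Ω →ᵇ ℝ, 0 ≤ g → 0 ≤ weightedOp (translateOp Γ) g := fun g hg x => by
    have h := (hasSum_weightedOp_apply (ι := Γ) norm_translateOp_le g).mapL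
      (BoundedContinuousFunction.evalCLM ℝ x)
    exact h.nonneg fun γ => mul_nonneg (unitWeight_pos γ).le (hg (γ • x))
  have hk : ∀ k : ℕ, 0 ≤ (weightedOp (translateOp Γ) ^ k) f := fun k => by
    induction k with
    | zero => simpa using hf
    | succ k ih => rw [pow_succ', mul_apply_eq_comp]; exact hT _ ih
  rw [avgFun, avgOp_apply]
  have hsum := Finset.sum_nonneg fun k (_ : k ∈ Finset.range (n + 1)) => hk k
  exact fun x => mul_nonneg (by positivity) (hsum x)

variable [MeasurableSpace Ω] [BorelSpace Ω] (ν : Measure Ω) [IsProbabilityMeasure ν]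
  [SMulInvariantMeasure Γ Ω ν]

theorem integral_avgFun (n : ℕ) (f : Ω →ᵇ ℝ) : ∫ x, avgFun Γ n f x ∂ν = ∫ x, f x ∂ν := by
  let I : (Ω →ᵇ ℝ) →L[ℝ] ℝ := WeakDual.toStrongDual (toDual ⟨ν, inferInstance⟩)
  have h := avgOp_comm (ι := Γ) (U' := fun _ => ContinuousLinearMap.id ℝ ℝ)
    (U := translateOp Γ) norm_translateOp_le (fun _ => ContinuousLinearMap.norm_id_le)
    I (fun γ g => (measurePreserving_smul γ ν).integral_comp
      (measurableEmbedding_const_smul γ) g) n f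
  rw [avgOp_id] at h
  exact h

theorem integral_sub_sq_eq_norm (f : Ω →ᵇ ℝ) (w : Lp ℝ 2 ν) :
    ∫ x, (f x - w x) ^ 2 ∂ν = ‖BoundedContinuousFunction.toLp 2 ν ℝ f - w‖ ^ 2 := by
  rw [← real_inner_self_eq_norm_sq, L2.inner_def]
  refine integral_congr_ae ?_
  filter_upwards [Lp.coeFn_sub (BoundedContinuousFunction.toLp 2 ν ℝ f) w,
    BoundedContinuousFunction.coeFn_toLp (p := 2) (μ := ν) (𝕜 := ℝ) f] with x h1 h2
  simp only [h1, Pi.sub_apply, h2]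
  simp [sq]

theorem toLp_avgFun (n : ℕ) (f : Ω →ᵇ ℝ) :
    BoundedContinuousFunction.toLp 2 ν ℝ (avgFun Γ n f) =
      avgOp (koopman ν (Γ := Γ)) n (BoundedContinuousFunction.toLp 2 ν ℝ f) := by
  refine avgOp_comm norm_translateOp_le (norm_koopman_le ν (Γ := Γ))
    (BoundedContinuousFunction.toLp 2 ν ℝ) (fun γ g => Lp.ext ?_) n f
  have h1 := (BoundedContinuousFunction.coeFn_toLp (p := 2) (μ := ν) (𝕜 := ℝ) g)
  filter_upwards [koopman_ae_eq ν γ (BoundedContinuousFunction.toLp 2 ν ℝ g),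
    BoundedContinuousFunction.coeFn_toLp (p := 2) (μ := ν) (𝕜 := ℝ) (translateOp Γ γ g),
    (measurePreserving_smul γ ν).quasiMeasurePreserving.ae h1] with x h2 h3 h4
  rw [h2, h3, h4, translateOp_apply]

/-- The mean ergodic theorem: the averages of `f` converge in `L²(ν)` to an invariant function. -/
theorem exists_tendsto_avgFun (f : Ω →ᵇ ℝ) :
    ∃ h : Ω → ℝ, Measurable h ∧ MemLp h 2 ν ∧ (∀ γ : Γ, (fun x => h (γ • x)) =ᵐ[ν] h) ∧
      Tendsto (fun n => ∫ x, (avgFun Γ n f x - h x) ^ 2 ∂ν) atTop (𝓝 0) := by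
  obtain ⟨w, hw, ht⟩ := exists_tendsto_avgOp (norm_koopman_le ν (Γ := Γ))
    (BoundedContinuousFunction.toLp 2 ν ℝ f)
  refine ⟨w, (Lp.stronglyMeasurable w).measurable, Lp.memLp w, fun γ => ?_, ?_⟩
  · have := koopman_ae_eq ν γ w
    rw [hw γ] at this
    exact this.symm
  · have h0 : Tendsto (fun n => ‖avgOp (koopman ν (Γ := Γ)) n
        (BoundedContinuousFunction.toLp 2 ν ℝ f) - w‖ ^ 2) atTop (𝓝 0) := by
      simpa using ((ht.sub_const w).norm.pow 2)
    refine h0.congr fun n => ?_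
    rw [integral_sub_sq_eq_norm, toLp_avgFun]

theorem exists_tendsto_integral_avgFun_sq (f : Ω →ᵇ ℝ) :
    ∃ s : ℝ, Tendsto (fun n => ∫ x, avgFun Γ n f x ^ 2 ∂ν) atTop (𝓝 s) := by
  obtain ⟨w, -, ht⟩ := exists_tendsto_avgOp (norm_koopman_le ν (Γ := Γ))
    (BoundedContinuousFunction.toLp 2 ν ℝ f)
  refine ⟨‖w‖ ^ 2, (ht.norm.pow 2).congr fun n => ?_⟩
  rw [← toLp_avgFun, ← sub_zero (BoundedContinuousFunction.toLp 2 ν ℝ (avgFun Γ n f)),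
    ← integral_sub_sq_eq_norm]
  refine integral_congr_ae ((Lp.coeFn_zero ℝ 2 ν).mono fun x hx => ?_)
  simp only [hx, Pi.zero_apply, sub_zero]

/-- For an ergodic measure, the averages of `f` converge to the mean of `f`. -/
theorem tendsto_avgFun_of_ergodic (ν : Measure Ω) [IsProbabilityMeasure ν] [ErgodicSMul Γ Ω ν]
    (f : Ω →ᵇ ℝ) :
    Tendsto (fun n => ∫ x, (avgFun Γ n f x - ∫ y, f y ∂ν) ^ 2 ∂ν) atTop (𝓝 0) := by
  obtain ⟨h, hm, hL, hinv, ht⟩ := exists_tendsto_avgFun Γ ν f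
  obtain ⟨c, hc⟩ := ae_eq_const_of_invariant (Γ := Γ) hm.aestronglyMeasurable hinv
  have ht' : Tendsto (fun n => ∫ x, (avgFun Γ n f x - c) ^ 2 ∂ν) atTop (𝓝 0) := by
    refine ht.congr fun n => integral_congr_ae (hc.mono fun x hx => ?_)
    simp only [hx, Function.const_apply]
  have hb : ∀ n, (∫ y, f y ∂ν - c) ^ 2 ≤ ∫ x, (avgFun Γ n f x - c) ^ 2 ∂ν := fun n => by
    have := sq_integral_le ((memLp_boundedContinuous (ν := ν) (avgFun Γ n f)).sub (memLp_const c))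
    simp only [Pi.sub_apply] at this
    rwa [integral_sub ((avgFun Γ n f).integrable ν) (integrable_const c), integral_avgFun,
      integral_const, probReal_univ, one_smul] at this
  have h0 : (∫ y, f y ∂ν - c) ^ 2 ≤ 0 := ge_of_tendsto' ht' hb
  have h1 : ∫ y, f y ∂ν = c := by nlinarith
  rwa [h1]

end AvgFun

/-! ### The space of probability measures on a compact metrizable space -/

section ProbSpace

variable {Ω : Type*} [TopologicalSpace Ω] [MeasurableSpace Ω]

/-- Integration of `f`, as a bounded continuous function on the space of probability measures. -/
noncomputable def evalInt [OpensMeasurableSpace Ω] (f : Ω →ᵇ ℝ) : ProbabilityMeasure Ω →ᵇ ℝ :=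
  BoundedContinuousFunction.ofNormedAddCommGroup (fun ν : ProbabilityMeasure Ω => ∫ x, f x ∂(ν : Measure Ω))
    (ProbabilityMeasure.continuous_integral_boundedContinuousFunction f) ‖f‖
    fun _ => f.norm_integral_le_norm _

@[simp]
theorem evalInt_apply [OpensMeasurableSpace Ω] (f : Ω →ᵇ ℝ) (ν : ProbabilityMeasure Ω) :
    evalInt f ν = ∫ x, f x ∂(ν : Measure Ω) := rfl

theorem continuous_probToDual [OpensMeasurableSpace Ω] :
    Continuous (toDual : ProbabilityMeasure Ω → WeakDual ℝ (Ω →ᵇ ℝ)) :=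
  WeakDual.continuous_of_continuous_eval fun f =>
    ProbabilityMeasure.continuous_integral_boundedContinuousFunction f

/-- Every continuous functional on the weak-* dual is the evaluation at some vector. -/
theorem WeakDual.exists_eq_eval {F : Type*} [AddCommGroup F] [Module ℝ F] [TopologicalSpace F]
    (u : WeakDual ℝ F →L[ℝ] ℝ) : ∃ f : F, ∀ φ : WeakDual ℝ F, u φ = φ f := by
  obtain ⟨f, hf⟩ := LinearMap.dualEmbedding_surjective (topDualPairing ℝ F) u
  exact ⟨f, fun φ => (DFunLike.congr_fun hf φ).symm⟩

theorem WeakDual.exists_lt_of_notMem {F : Type*} [AddCommGroup F] [Module ℝ F]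
    [TopologicalSpace F] {L : Set (WeakDual ℝ F)} (hconv : Convex ℝ L) (hcl : IsClosed L)
    {ξ : WeakDual ℝ F} (hξ : ξ ∉ L) : ∃ (f : F) (c : ℝ), ξ f < c ∧ ∀ φ ∈ L, c < φ f := by
  obtain ⟨u, c, h1, h2⟩ := geometric_hahn_banach_point_closed hconv hcl hξ
  obtain ⟨f, hf⟩ := WeakDual.exists_eq_eval u
  exact ⟨f, c, by rwa [← hf], fun φ hφ => by rw [← hf]; exact h2 φ hφ⟩

/-- `x` is the barycenter of the probability measure `m` on the space of probability measures. -/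
def IsBarycenter [OpensMeasurableSpace Ω] (m : Measure (ProbabilityMeasure Ω))
    (x : ProbabilityMeasure Ω) : Prop :=
  ∀ f : Ω →ᵇ ℝ, ∫ e, evalInt f e ∂m = ∫ x, f x ∂(x : Measure Ω)

variable [BorelSpace Ω]

theorem probToDual_injective [TopologicalSpace.MetrizableSpace Ω] :
    Function.Injective (toDual : ProbabilityMeasure Ω → WeakDual ℝ (Ω →ᵇ ℝ)) := fun _ _ h =>
  ProbabilityMeasure.toMeasure_injective
    (ext_of_forall_integral_eq_of_IsFiniteMeasure fun f => DFunLike.congr_fun h f)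

variable [CompactSpace Ω]

/-- The Riesz representation theorem, for positive normalized functionals. -/
theorem exists_probabilityMeasure_of_nonneg [T2Space Ω] (Λ : (Ω →ᵇ ℝ) →ₗ[ℝ] ℝ)
    (hpos : ∀ f, 0 ≤ f → 0 ≤ Λ f) (h1 : Λ 1 = 1) :
    ∃ ν : ProbabilityMeasure Ω, ∀ f : Ω →ᵇ ℝ, ∫ x, f x ∂(ν : Measure Ω) = Λ f := by
  let J : CompactlySupportedContinuousMap Ω ℝ →ₗ[ℝ] (Ω →ᵇ ℝ) :=
    { toFun := fun f => BoundedContinuousFunction.mkOfCompact f.toContinuousMap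
      map_add' := fun f g => rfl
      map_smul' := fun c f => rfl }
  let Λ' : CompactlySupportedContinuousMap Ω ℝ →ₚ[ℝ] ℝ :=
    PositiveLinearMap.mk₀ (Λ ∘ₗ J) fun f hf => hpos _ fun x => hf x
  have key : ∀ f : Ω →ᵇ ℝ, ∫ x, f x ∂(RealRMK.rieszMeasure Λ') = Λ f := fun f =>
    RealRMK.integral_rieszMeasure Λ' (CompactlySupportedContinuousMap.continuousMapEquiv
      f.toContinuousMap)
  have hfin : IsFiniteMeasure (RealRMK.rieszMeasure Λ') :=
    ⟨isCompact_univ.measure_lt_top⟩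
  have hprob : IsProbabilityMeasure (RealRMK.rieszMeasure Λ') := by
    rw [isProbabilityMeasure_iff_real]
    simpa [h1] using key 1
  exact ⟨⟨_, hprob⟩, key⟩

variable [TopologicalSpace.MetrizableSpace Ω]

theorem isClosedEmbedding_probToDual :
    IsClosedEmbedding (toDual : ProbabilityMeasure Ω → WeakDual ℝ (Ω →ᵇ ℝ)) :=
  continuous_probToDual.isClosedEmbedding probToDual_injective

theorem exists_toDual_eq_convexComb (ν ν' : ProbabilityMeasure Ω) {s t : ℝ} (hs : 0 ≤ s)
    (ht : 0 ≤ t) (hst : s + t = 1) :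
    ∃ ξ : ProbabilityMeasure Ω, toDual ξ = s • toDual ν + t • toDual ν' := by
  obtain ⟨ξ, hξ⟩ := exists_probabilityMeasure_of_nonneg
    ((s • toDual ν + t • toDual ν' : WeakDual ℝ (Ω →ᵇ ℝ)).toLinearMap)
    (fun f hf => add_nonneg (mul_nonneg hs (integral_nonneg hf))
      (mul_nonneg ht (integral_nonneg hf)))
    (by
      change s * (∫ _, (1 : ℝ) ∂(ν : Measure Ω)) + t * (∫ _, (1 : ℝ) ∂(ν' : Measure Ω)) = 1
      simp [hst])
  exact ⟨ξ, DFunLike.ext _ _ hξ⟩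

instance : TopologicalSpace.SeparableSpace (Ω →ᵇ ℝ) :=
  (ContinuousMap.isometryEquivBoundedOfCompact Ω ℝ).surjective.denseRange.separableSpace
    (ContinuousMap.isometryEquivBoundedOfCompact Ω ℝ).continuous

/-- The Giry σ-algebra is the Borel σ-algebra of the weak topology. -/
instance : BorelSpace (ProbabilityMeasure Ω) := by
  constructor
  apply le_antisymm
  · let _ : MeasurableSpace (ProbabilityMeasure Ω) := borel _
    have : BorelSpace (ProbabilityMeasure Ω) := ⟨rfl⟩
    have h : Measurable fun ν : ProbabilityMeasure Ω => (ν : Measure Ω) := by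
      refine Measurable.measure_of_isPiSystem_of_isProbabilityMeasure
        (S := {s | IsClosed s}) (BorelSpace.measurable_eq.trans borel_eq_generateFrom_isClosed)
        (fun s hs t ht _ => IsClosed.inter hs ht) fun F (hF : IsClosed F) => ?_
      refine measurable_of_tendsto_metrizable (fun n => ?_) (tendsto_pi_nhds.2 fun ν =>
        HasOuterApproxClosed.tendsto_lintegral_apprSeq hF (ν : Measure Ω))
      exact (ProbabilityMeasure.continuous_lintegral_boundedContinuousFunction
        (hF.apprSeq n)).measurable
    exact h.comap_le
  · let d := TopologicalSpace.denseSeq (Ω →ᵇ ℝ)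
    let T : ProbabilityMeasure Ω → ℕ → ℝ := fun ν n => ∫ x, d n x ∂(ν : Measure Ω)
    have hcont : Continuous T := continuous_pi fun n =>
      ProbabilityMeasure.continuous_integral_boundedContinuousFunction (d n)
    have hinj : Function.Injective T := fun a b h => by
      refine probToDual_injective (DFunLike.coe_injective ?_)
      exact (TopologicalSpace.denseRange_denseSeq _).equalizer
        (WeakDual.toStrongDual (toDual a)).continuous
        (WeakDual.toStrongDual (toDual b)).continuous (funext fun n => congrFun h n)
    have hmeas : Measurable T := measurable_pi_lambda _ fun n => by
      have h1 : StronglyMeasurable fun ν : ProbabilityMeasure Ω => ∫ x, d n x ∂(ν : Measure Ω) := by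
        let κ : ProbabilityTheory.Kernel (ProbabilityMeasure Ω) Ω := ⟨_, measurable_subtype_coe⟩
        exact ((d n).continuous.stronglyMeasurable).integral_kernel (κ := κ)
      exact h1.measurable
    rw [((hcont.isClosedEmbedding hinj).isInducing).eq_induced, borel_comap,
      ← BorelSpace.measurable_eq (α := ℕ → ℝ)]
    exact hmeas.comap_le

theorem mem_of_isBarycenter {L : Set (WeakDual ℝ (Ω →ᵇ ℝ))} (hconv : Convex ℝ L)
    (hcl : IsClosed L) (m : Measure (ProbabilityMeasure Ω)) [IsProbabilityMeasure m]
    (hm : ∀ᵐ e ∂m, toDual e ∈ L) {x : ProbabilityMeasure Ω} (hx : IsBarycenter m x) :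
    toDual x ∈ L := by
  by_contra h
  obtain ⟨f, c, h1, h2⟩ := WeakDual.exists_lt_of_notMem hconv hcl h
  have h3 : c ≤ ∫ e, evalInt f e ∂m := by
    have : ∫ _, c ∂m ≤ ∫ e, evalInt f e ∂m :=
      integral_mono_ae (integrable_const c) ((evalInt f).integrable m)
        (hm.mono fun e he => (h2 _ he).le)
    simpa using this
  rw [hx f] at h3
  exact absurd h1 (not_lt.2 h3)

/-- Every probability measure on the space of probability measures has a barycenter. -/
theorem exists_isBarycenter (m : Measure (ProbabilityMeasure Ω)) [IsProbabilityMeasure m] :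
    ∃ x, IsBarycenter m x := by
  let Λ : (Ω →ᵇ ℝ) →ₗ[ℝ] ℝ :=
    { toFun := fun f => ∫ e, evalInt f e ∂m
      map_add' := fun f g => by
        rw [← integral_add ((evalInt f).integrable m) ((evalInt g).integrable m)]
        exact integral_congr_ae (ae_of_all _ fun e => (map_add (toDual e) f g))
      map_smul' := fun c f => by
        rw [RingHom.id_apply, smul_eq_mul, ← integral_const_mul]
        exact integral_congr_ae (ae_of_all _ fun e => (map_smul (toDual e) c f)) }
  obtain ⟨x, hx⟩ := exists_probabilityMeasure_of_nonneg Λ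
    (fun f hf => integral_nonneg fun e => integral_nonneg hf)
    (by simp [Λ])
  exact ⟨x, fun f => (hx f).symm⟩

/-- A partial converse of the Krein–Milman theorem: an extreme point of a closed convex set which
is the barycenter of a measure on a closed subset `S` belongs to `S`. -/
theorem mem_of_mem_extremePoints {L : Set (WeakDual ℝ (Ω →ᵇ ℝ))} (hconv : Convex ℝ L)
    (hcl : IsClosed L) {S : Set (ProbabilityMeasure Ω)} (hS : IsClosed S)
    (hSL : toDual '' S ⊆ L) (m : Measure (ProbabilityMeasure Ω)) [IsProbabilityMeasure m]
    (hm : ∀ᵐ e ∂m, e ∈ S) {x : ProbabilityMeasure Ω} (hx : IsBarycenter m x)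
    (hext : toDual x ∈ L.extremePoints ℝ) : x ∈ S := by
  have hmL : ∀ᵐ e ∂m, toDual e ∈ L := hm.mono fun e he => hSL ⟨e, he, rfl⟩
  -- Otherwise `x` is a proper convex combination of the barycenters of `m` conditioned on the half
  -- space and on its complement.
  have hmain : ∀ f : Ω →ᵇ ℝ, m {e | evalInt f e < evalInt f x} = 0 := by
    intro f
    set D : Set (ProbabilityMeasure Ω) := {e | evalInt f e < evalInt f x} with hD
    have hDm : MeasurableSet D :=
      (isOpen_lt (evalInt f).continuous continuous_const).measurableSet
    by_contra hpos
    have hlt : ∀ (m' : Measure (ProbabilityMeasure Ω)) [IsProbabilityMeasure m'],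
        (∀ᵐ e ∂m', e ∈ D) → ∫ e, evalInt f e ∂m' < evalInt f x := by
      intro m' _ h'
      have h0 : 0 < ∫ e, (evalInt f x - evalInt f e) ∂m' := by
        rw [integral_pos_iff_support_of_nonneg_ae (h'.mono fun e he => (sub_pos.2 he).le)
          ((integrable_const _).sub ((evalInt f).integrable m'))]
        have h'' : m' D = 1 := (prob_compl_eq_zero_iff hDm).1 h'
        exact zero_lt_one.trans_le (h''.symm.le.trans
          (measure_mono fun e (he : evalInt f e < evalInt f x) => (sub_pos.2 he).ne'))
      rw [integral_sub (integrable_const _) ((evalInt f).integrable m')] at h0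
      simpa using h0
    by_cases hc : m Dᶜ = 0
    · have := hlt m (ae_iff.2 hc)
      rw [hx f] at this
      exact lt_irrefl _ this
    have : IsProbabilityMeasure (ProbabilityTheory.cond m D) :=
      ProbabilityTheory.cond_isProbabilityMeasure hpos
    have : IsProbabilityMeasure (ProbabilityTheory.cond m Dᶜ) :=
      ProbabilityTheory.cond_isProbabilityMeasure hc
    obtain ⟨y, hy⟩ := exists_isBarycenter (ProbabilityTheory.cond m D)
    obtain ⟨z, hz⟩ := exists_isBarycenter (ProbabilityTheory.cond m Dᶜ)
    have hyL : toDual y ∈ L := mem_of_isBarycenter hconv hcl _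
      (ProbabilityTheory.cond_absolutelyContinuous.ae_le hmL) hy
    have hzL : toDual z ∈ L := mem_of_isBarycenter hconv hcl _
      (ProbabilityTheory.cond_absolutelyContinuous.ae_le hmL) hz
    have h1 : 0 < m.real D := by
      rw [measureReal_def]; exact ENNReal.toReal_pos hpos (measure_ne_top _ _)
    have h2 : 0 < m.real Dᶜ := by
      rw [measureReal_def]; exact ENNReal.toReal_pos hc (measure_ne_top _ _)
    have hsum : m.real D + m.real Dᶜ = 1 := probReal_add_probReal_compl hDm
    have hseg : toDual x ∈ openSegment ℝ (toDual y) (toDual z) := by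
      refine ⟨m.real D, m.real Dᶜ, h1, h2, hsum, DFunLike.ext _ _ fun g => ?_⟩
      change m.real D * (∫ w, g w ∂(y : Measure Ω)) + m.real Dᶜ * (∫ w, g w ∂(z : Measure Ω)) =
        ∫ w, g w ∂(x : Measure Ω)
      rw [← hy g, ← hz g, ← hx g, ← integral_add_compl hDm ((evalInt g).integrable m)]
      simp only [ProbabilityTheory.cond, integral_smul_measure, ENNReal.toReal_inv, smul_eq_mul]
      rw [← measureReal_def, ← measureReal_def, mul_inv_cancel_left₀ h1.ne',
        mul_inv_cancel_left₀ h2.ne']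
    have hxy : toDual y = toDual x := (mem_extremePoints.1 hext).2 _ hyL _ hzL hseg |>.1
    have h3 := hlt (ProbabilityTheory.cond m D) (ProbabilityTheory.ae_cond_mem hDm)
    rw [hy f] at h3
    exact h3.ne (DFunLike.congr_fun hxy f)
  by_contra hxS
  have hnull : m S = 0 := by
    refine measure_null_of_locally_null S fun e he => ?_
    have hne : e ≠ x := fun h => hxS (h ▸ he)
    obtain ⟨f, hf⟩ : ∃ f : Ω →ᵇ ℝ, evalInt f e < evalInt f x := by
      by_contra! hcon
      refine hne (probToDual_injective (DFunLike.ext _ _ fun f => le_antisymm ?_ (hcon f)))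
      have := hcon (-f)
      simp only [evalInt_apply, BoundedContinuousFunction.coe_neg, Pi.neg_apply,
        integral_neg] at this
      exact neg_le_neg_iff.1 this
    exact ⟨_, mem_nhdsWithin_of_mem_nhds
      ((isOpen_lt (evalInt f).continuous continuous_const).mem_nhds hf), hmain f⟩
  have h1 : m S = 1 := (prob_compl_eq_zero_iff hS.measurableSet).1 hm
  simp [hnull] at h1

end ProbSpace

/-! ### Ergodic decomposition -/

section ErgodicDecomposition

variable (Γ : Type*) {Ω : Type*} [Group Γ] [TopologicalSpace Ω] [MeasurableSpace Ω] [BorelSpace Ω]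
  [MulAction Γ Ω] [ContinuousConstSMul Γ Ω]

variable (Ω) in
/-- The invariant Borel probability measures of a continuous action. -/
def invMeasures : Set (ProbabilityMeasure Ω) :=
  {ν | ∀ γ : Γ, (ν : Measure Ω).map (γ • ·) = ν}

variable {Γ} in
theorem smulInvariantMeasure_of_mem {ν : ProbabilityMeasure Ω} (h : ν ∈ invMeasures Γ Ω) :
    SMulInvariantMeasure Γ Ω (ν : Measure Ω) :=
  ⟨fun γ s hs => by
    conv_rhs => rw [← h γ]
    rw [Measure.map_apply (measurable_const_smul γ) hs]⟩

variable [Countable Γ]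

/-- If the averages of all functions of a dense set converge to constants in `L²(e)`, then `e` is
an extreme point of the set of invariant measures: a component `a ≤ e / s` of `e` has the same
averages. -/
theorem mem_extremePoints_of_tendsto {e : ProbabilityMeasure Ω} (he : e ∈ invMeasures Γ Ω)
    {D : Set (Ω →ᵇ ℝ)} (hD : Dense D)
    (h : ∀ f ∈ D, Tendsto (fun n => ∫ x, (avgFun Γ n f x - ∫ y, f y ∂(e : Measure Ω)) ^ 2
      ∂(e : Measure Ω)) atTop (𝓝 0)) :
    toDual e ∈ (toDual '' invMeasures Γ Ω).extremePoints ℝ := by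
  rw [mem_extremePoints_iff_left]
  refine ⟨⟨e, he, rfl⟩, ?_⟩
  rintro _ ⟨a, ha, rfl⟩ _ ⟨b, hb, rfl⟩ ⟨s, t, hs, ht, hst, heq⟩
  have := smulInvariantMeasure_of_mem ha
  refine DFunLike.coe_injective ?_
  refine Continuous.ext_on hD (WeakDual.toStrongDual (toDual a)).continuous
    (WeakDual.toStrongDual (toDual e)).continuous fun f hf => ?_
  change ∫ y, f y ∂(a : Measure Ω) = ∫ y, f y ∂(e : Measure Ω)
  set c := ∫ y, f y ∂(e : Measure Ω) with hc
  have hb : ∀ n, (∫ y, f y ∂(a : Measure Ω) - c) ^ 2 ≤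
      s⁻¹ * ∫ x, (avgFun Γ n f x - c) ^ 2 ∂(e : Measure Ω) := fun n => by
    have h1 := sq_integral_le ((memLp_boundedContinuous (ν := (a : Measure Ω))
      (avgFun Γ n f)).sub (memLp_const c))
    simp only [Pi.sub_apply] at h1
    rw [integral_sub ((avgFun Γ n f).integrable _) (integrable_const c), integral_avgFun,
      integral_const, probReal_univ, one_smul] at h1
    refine h1.trans ?_
    let g : Ω →ᵇ ℝ := (avgFun Γ n f - BoundedContinuousFunction.const Ω c) ^ 2
    have h2 : s * (∫ x, g x ∂(a : Measure Ω)) + t * (∫ x, g x ∂(b : Measure Ω)) =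
      ∫ x, g x ∂(e : Measure Ω) := DFunLike.congr_fun heq g
    have h3 : 0 ≤ ∫ x, g x ∂(b : Measure Ω) := integral_nonneg fun x => sq_nonneg _
    rw [le_inv_mul_iff₀ hs]
    have h4 := mul_nonneg ht.le h3
    change s * (∫ x, g x ∂(a : Measure Ω)) ≤ ∫ x, g x ∂(e : Measure Ω)
    linarith
  have h0 := ge_of_tendsto' ((h f hf).const_mul s⁻¹) hb
  rw [mul_zero] at h0
  nlinarith

theorem mem_extremePoints_of_ergodic (e : ProbabilityMeasure Ω)
    [ErgodicSMul Γ Ω (e : Measure Ω)] :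
    toDual e ∈ (toDual '' invMeasures Γ Ω).extremePoints ℝ :=
  mem_extremePoints_of_tendsto Γ (fun γ => (measurePreserving_smul γ (e : Measure Ω)).map_eq)
    dense_univ fun f _ => tendsto_avgFun_of_ergodic Γ (e : Measure Ω) f

/-- The continuous functions `F` on the space of measures that are computed on all ergodic measures
by a single bounded sequence of continuous functions `G n` on `Ω`: for `e` ergodic, `G n` converges
to the constant `F e` in `L¹(e)`. -/
def IsErgodicLimit (F : ProbabilityMeasure Ω →ᵇ ℝ) : Prop :=
  ∃ (G : ℕ → Ω →ᵇ ℝ) (M : ℝ), (∀ n, ‖G n‖ ≤ M) ∧ ∀ e : ProbabilityMeasure Ω,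
    ErgodicSMul Γ Ω (e : Measure Ω) →
      Tendsto (fun n => ∫ x, |G n x - F e| ∂(e : Measure Ω)) atTop (𝓝 0)

theorem isErgodicLimit_evalInt (f : Ω →ᵇ ℝ) : IsErgodicLimit Γ (evalInt f) :=
  ⟨fun n => avgFun Γ n f, ‖f‖, fun n => norm_avgFun_apply_le Γ n f, fun e _ =>
    tendsto_integral_abs_of_sq (fun _ => (memLp_boundedContinuous _).sub (memLp_const _))
      (tendsto_avgFun_of_ergodic Γ (e : Measure Ω) f)⟩

variable [CompactSpace Ω] [TopologicalSpace.MetrizableSpace Ω]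

/-- The functions that are limits of averages on ergodic measures form an algebra. -/
noncomputable def ergodicLimits : StarSubalgebra ℝ (ProbabilityMeasure Ω →ᵇ ℝ) where
  carrier := {F | IsErgodicLimit Γ F}
  mul_mem' := by
    rintro F F' ⟨G, M, hM, h⟩ ⟨G', M', hM', h'⟩
    refine ⟨fun n => G n * G' n, M * M', fun n => (norm_mul_le _ _).trans
      (mul_le_mul (hM n) (hM' n) (norm_nonneg _) ((norm_nonneg _).trans (hM n))), fun e he => ?_⟩
    have hlim := ((h' e he).const_mul M).add ((h e he).const_mul |F' e|)
    simp only [mul_zero, add_zero] at hlim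
    refine squeeze_zero (fun n => integral_nonneg fun x => abs_nonneg _) (fun n => ?_) hlim
    have i1 : Integrable (fun x => |G n x - F e|) (e : Measure Ω) :=
      (((G n).integrable _).sub (integrable_const _)).abs
    have i2 : Integrable (fun x => |G' n x - F' e|) (e : Measure Ω) :=
      (((G' n).integrable _).sub (integrable_const _)).abs
    have i3 : Integrable (fun x => |(G n * G' n) x - (F * F') e|) (e : Measure Ω) :=
      (((G n * G' n).integrable _).sub (integrable_const _)).abs
    rw [← integral_const_mul, ← integral_const_mul,
      ← integral_add (i2.const_mul _) (i1.const_mul _)]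
    refine integral_mono i3 ((i2.const_mul _).add (i1.const_mul _)) fun x => ?_
    have h1 : |G n x| ≤ M := ((G n).norm_coe_le_norm x).trans (hM n)
    calc |G n x * G' n x - F e * F' e|
        = |G n x * (G' n x - F' e) + F' e * (G n x - F e)| := by congr 1; ring
      _ ≤ |G n x| * |G' n x - F' e| + |F' e| * |G n x - F e| := by
          rw [← abs_mul, ← abs_mul]; exact abs_add_le _ _
      _ ≤ M * |G' n x - F' e| + |F' e| * |G n x - F e| := by gcongr
  add_mem' := by
    rintro F F' ⟨G, M, hM, h⟩ ⟨G', M', hM', h'⟩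
    refine ⟨fun n => G n + G' n, M + M', fun n => (norm_add_le _ _).trans
      (add_le_add (hM n) (hM' n)), fun e he => ?_⟩
    have hlim := (h e he).add (h' e he)
    simp only [add_zero] at hlim
    refine squeeze_zero (fun n => integral_nonneg fun x => abs_nonneg _) (fun n => ?_) hlim
    have i1 : Integrable (fun x => |G n x - F e|) (e : Measure Ω) :=
      (((G n).integrable _).sub (integrable_const _)).abs
    have i2 : Integrable (fun x => |G' n x - F' e|) (e : Measure Ω) :=
      (((G' n).integrable _).sub (integrable_const _)).abs
    have i3 : Integrable (fun x => |(G n + G' n) x - (F + F') e|) (e : Measure Ω) :=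
      (((G n + G' n).integrable _).sub (integrable_const _)).abs
    rw [← integral_add i1 i2]
    refine integral_mono i3 (i1.add i2) fun x => ?_
    calc |G n x + G' n x - (F e + F' e)| = |(G n x - F e) + (G' n x - F' e)| := by
          congr 1; ring
      _ ≤ _ := abs_add_le _ _
  algebraMap_mem' := fun c => ⟨fun _ => algebraMap ℝ _ c, _, fun _ => le_rfl, fun e _ => by
    simp⟩
  star_mem' := fun {F} hF => by
    have : star F = F := by ext; simp
    exact this ▸ hF

/-- **Uniqueness of the ergodic decomposition.** For `F` in the algebra `ergodicLimits`, with
approximating functions `G n`, the integral of `F` is the limit of `∫ G n dx`, so it depends on the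
barycenter `x` only. -/
theorem eq_of_isBarycenter_of_ergodic {m m' : Measure (ProbabilityMeasure Ω)}
    [IsProbabilityMeasure m] [IsProbabilityMeasure m'] {x : ProbabilityMeasure Ω}
    (hm : IsBarycenter m x) (hm' : IsBarycenter m' x)
    (he : ∀ᵐ e : ProbabilityMeasure Ω ∂m, ErgodicSMul Γ Ω (e : Measure Ω))
    (he' : ∀ᵐ e : ProbabilityMeasure Ω ∂m', ErgodicSMul Γ Ω (e : Measure Ω)) : m = m' := by
  have : PolishSpace (ProbabilityMeasure Ω) := by
    let := TopologicalSpace.metrizableSpaceMetric (ProbabilityMeasure Ω)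
    infer_instance
  refine ext_of_forall_mem_subalgebra_integral_eq_of_polish (𝕜 := ℝ)
    (A := ergodicLimits Γ) ?_ ?_
  · intro a b hab
    obtain ⟨f, hf⟩ : ∃ f : Ω →ᵇ ℝ, evalInt f a ≠ evalInt f b := by
      by_contra! hcon
      exact hab (probToDual_injective (DFunLike.ext _ _ hcon))
    exact ⟨_, ⟨_, ⟨evalInt f, isErgodicLimit_evalInt Γ f, rfl⟩, rfl⟩, hf⟩
  · rintro F ⟨G, M, hM, h⟩
    have key : ∀ (k : Measure (ProbabilityMeasure Ω)) [IsProbabilityMeasure k],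
        IsBarycenter k x → (∀ᵐ e : ProbabilityMeasure Ω ∂k, ErgodicSMul Γ Ω (e : Measure Ω)) →
        Tendsto (fun n => ∫ y, G n y ∂(x : Measure Ω)) atTop (𝓝 (∫ e, F e ∂k)) := by
      intro k _ hk hek
      have : ∀ n, ∫ y, G n y ∂(x : Measure Ω) = ∫ e, evalInt (G n) e ∂k := fun n => (hk _).symm
      simp_rw [this]
      refine tendsto_integral_of_dominated_convergence (fun _ => M)
        (fun n => (evalInt (G n)).continuous.measurable.aestronglyMeasurable)
        (integrable_const M) (fun n => ae_of_all _ fun e =>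
          ((G n).norm_integral_le_norm _).trans (hM n)) ?_
      filter_upwards [hek] with e hee
      rw [tendsto_iff_norm_sub_tendsto_zero]
      refine squeeze_zero (fun n => norm_nonneg _) (fun n => ?_) (h e hee)
      have : evalInt (G n) e - F e = ∫ y, (G n y - F e) ∂(e : Measure Ω) := by
        rw [integral_sub ((G n).integrable _) (integrable_const _)]
        simp
      rw [this]
      exact abs_integral_le_integral_abs
    exact tendsto_nhds_unique (key m hm he) (key m' hm' he')

end ErgodicDecomposition

section ErgodicDecompositionExistence

variable (Γ : Type*) {Ω : Type*} [Group Γ] [TopologicalSpace Ω] [MeasurableSpace Ω] [BorelSpace Ω]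
  [MulAction Γ Ω] [ContinuousConstSMul Γ Ω] [Countable Γ]

/-- If conditioning `ν` on invariant sets produces only measures `η` with `c ≤ ∫ f dη`, then the
limit `h` of the averages of `f` is at least `c`. -/
theorem le_of_forall_cond (ν : Measure Ω) [IsProbabilityMeasure ν] [SMulInvariantMeasure Γ Ω ν]
    {f : Ω →ᵇ ℝ} {h : Ω → ℝ} (hm : Measurable h) (hL : MemLp h 2 ν)
    (hinv : ∀ γ : Γ, (fun x => h (γ • x)) =ᵐ[ν] h)
    (ht : Tendsto (fun n => ∫ x, (avgFun Γ n f x - h x) ^ 2 ∂ν) atTop (𝓝 0)) {c : ℝ}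
    (hc : ∀ A : Set Ω, MeasurableSet A → (∀ γ : Γ, (γ • ·) ⁻¹' A =ᵐ[ν] A) → ν A ≠ 0 →
      SMulInvariantMeasure Γ Ω (ProbabilityTheory.cond ν A) ∧
        c < ∫ x, f x ∂(ProbabilityTheory.cond ν A)) :
    ∀ᵐ x ∂ν, c ≤ h x := by
  set A : Set Ω := {x | h x < c} with hA
  have hAm : MeasurableSet A := hm measurableSet_Iio
  have hAinv : ∀ γ : Γ, (γ • ·) ⁻¹' A =ᵐ[ν] A := fun γ => (hinv γ).preimage (Set.Iio c)
  by_contra hcon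
  have hA0 : ν A ≠ 0 := fun h0 => hcon (by
    filter_upwards [measure_eq_zero_iff_ae_notMem.1 h0] with x hx
    exact not_lt.1 hx)
  obtain ⟨h1, h2⟩ := hc A hAm hAinv hA0
  have hprob := ProbabilityTheory.cond_isProbabilityMeasure hA0
  have hpos : 0 < ν.real A := by
    rw [measureReal_def]; exact ENNReal.toReal_pos hA0 (measure_ne_top _ _)
  have hcond : ∀ g : Ω → ℝ, ∫ x, g x ∂(ProbabilityTheory.cond ν A) =
      (ν.real A)⁻¹ * ∫ x in A, g x ∂ν := fun g => by
    simp only [ProbabilityTheory.cond, integral_smul_measure, ENNReal.toReal_inv, smul_eq_mul,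
      measureReal_def]
  have habs := tendsto_integral_abs_of_sq
    (fun n => (memLp_boundedContinuous (ν := ν) (avgFun Γ n f)).sub hL) ht
  have hlim : Tendsto (fun n => ∫ x in A, avgFun Γ n f x ∂ν) atTop (𝓝 (∫ x in A, h x ∂ν)) := by
    rw [tendsto_iff_norm_sub_tendsto_zero]
    refine squeeze_zero (fun n => norm_nonneg _) (fun n => ?_) habs
    have i1 : Integrable (fun x => avgFun Γ n f x - h x) ν :=
      ((avgFun Γ n f).integrable ν).sub (hL.integrable one_le_two)
    rw [← integral_sub ((avgFun Γ n f).integrable _) (hL.integrable one_le_two).integrableOn]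
    exact (abs_integral_le_integral_abs).trans
      (setIntegral_le_integral i1.abs (ae_of_all _ fun x => abs_nonneg _))
  have hconst : ∀ n, ∫ x in A, avgFun Γ n f x ∂ν =
      ν.real A * ∫ x, f x ∂(ProbabilityTheory.cond ν A) := fun n => by
    rw [← integral_avgFun Γ (ProbabilityTheory.cond ν A) n f, hcond, mul_inv_cancel_left₀ hpos.ne']
  simp_rw [hconst] at hlim
  have heq := tendsto_nhds_unique hlim tendsto_const_nhds
  have hle : ∫ x in A, h x ∂ν ≤ ν.real A * c := by
    have := setIntegral_mono_on (hL.integrable one_le_two).integrableOn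
      (integrable_const c).integrableOn hAm fun x (hx : h x < c) => hx.le
    simpa [measureReal_def, smul_eq_mul] using this
  rw [heq] at hle
  exact absurd (le_of_mul_le_mul_left hle hpos) (not_le.2 h2)

variable [CompactSpace Ω] [TopologicalSpace.MetrizableSpace Ω]

/-- The averages `avgFun Γ n` are dual to a continuous map from `Ω` to probability measures. -/
theorem exists_continuous_avgMeasure (n : ℕ) : ∃ J : Ω → ProbabilityMeasure Ω, Continuous J ∧
    ∀ (f : Ω →ᵇ ℝ) (x : Ω), ∫ y, f y ∂(J x : Measure Ω) = avgFun Γ n f x := by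
  have h : ∀ x : Ω, ∃ ν : ProbabilityMeasure Ω, ∀ f : Ω →ᵇ ℝ,
      ∫ y, f y ∂(ν : Measure Ω) = avgFun Γ n f x := fun x =>
    exists_probabilityMeasure_of_nonneg
      ((BoundedContinuousFunction.evalCLM ℝ x).comp (avgFun Γ n) : (Ω →ᵇ ℝ) →ₗ[ℝ] ℝ)
      (fun f hf => avgFun_nonneg Γ n hf x)
      (by
        change avgFun Γ n (1 : Ω →ᵇ ℝ) x = 1
        rw [avgFun_one]; rfl)
  choose J hJ using h
  refine ⟨J, ?_, fun f x => hJ x f⟩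
  rw [ProbabilityMeasure.continuous_iff_forall_continuous_integral]
  intro f
  simp_rw [hJ]
  exact (avgFun Γ n f).continuous

/-- A limit `m` of the distributions of the averages, which is a candidate for the ergodic
decomposition of `x`. -/
theorem exists_limit_distribution (x : ProbabilityMeasure Ω) :
    ∃ (m : ProbabilityMeasure (ProbabilityMeasure Ω)) (φ : ℕ → ℕ), StrictMono φ ∧
      ∀ (f : Ω →ᵇ ℝ) (u : ℝ → ℝ), Continuous u →
        Tendsto (fun n => ∫ y, u (avgFun Γ (φ n) f y) ∂(x : Measure Ω)) atTop
          (𝓝 (∫ e, u (evalInt f e) ∂(m : Measure (ProbabilityMeasure Ω)))) := by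
  choose J hJc hJ using exists_continuous_avgMeasure Γ (Ω := Ω)
  obtain ⟨m, φ, hφ, hm⟩ := CompactSpace.tendsto_subseq
    fun n => x.map ((hJc n).measurable.aemeasurable (μ := (x : Measure Ω)))
  refine ⟨m, φ, hφ, fun f u hu => ?_⟩
  let F : ProbabilityMeasure Ω →ᵇ ℝ :=
    BoundedContinuousFunction.mkOfCompact ⟨fun e => u (evalInt f e), hu.comp (evalInt f).continuous⟩
  have h := ProbabilityMeasure.tendsto_iff_forall_integral_tendsto.1 hm F
  refine h.congr fun n => ?_
  simp only [Function.comp_apply, ProbabilityMeasure.toMeasure_map]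
  rw [integral_map ((hJc _).measurable.aemeasurable) F.continuous.measurable.aestronglyMeasurable]
  refine integral_congr_ae (ae_of_all _ fun y => ?_)
  change u (∫ z, f z ∂(J (φ n) y : Measure Ω)) = _
  rw [hJ]

/-- **Existence of the ergodic decomposition.** If the closed convex set `S` of invariant measures
contains the measures obtained by conditioning `x` on invariant sets, then `x` is the barycenter
of a measure on the points `e` of `S` for which the averages of a countable dense set of functions
converge to constants. -/
theorem exists_ergodic_decomposition {S : Set (ProbabilityMeasure Ω)} (hS : IsClosed S)
    (hconv : Convex ℝ (toDual '' S)) (hSinv : S ⊆ invMeasures Γ Ω) {x : ProbabilityMeasure Ω}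
    (hx : x ∈ invMeasures Γ Ω)
    (hcond : ∀ A : Set Ω, MeasurableSet A → (∀ γ : Γ, (γ • ·) ⁻¹' A =ᵐ[(x : Measure Ω)] A) →
      ∀ η : ProbabilityMeasure Ω, (x : Measure Ω) A ≠ 0 →
        (η : Measure Ω) = ProbabilityTheory.cond (x : Measure Ω) A → η ∈ S) :
    ∃ m : ProbabilityMeasure (ProbabilityMeasure Ω),
      IsBarycenter (m : Measure (ProbabilityMeasure Ω)) x ∧
      (∀ᵐ e : ProbabilityMeasure Ω ∂(m : Measure (ProbabilityMeasure Ω)), e ∈ S) ∧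
      ∀ᵐ e : ProbabilityMeasure Ω ∂(m : Measure (ProbabilityMeasure Ω)),
        ∀ f ∈ range (TopologicalSpace.denseSeq (Ω →ᵇ ℝ)),
        Tendsto (fun n => ∫ y, (avgFun Γ n f y - ∫ z, f z ∂(e : Measure Ω)) ^ 2
          ∂(e : Measure Ω)) atTop (𝓝 0) := by
  have := smulInvariantMeasure_of_mem hx
  obtain ⟨m, φ, hφ, hm⟩ := exists_limit_distribution Γ x
  have hφ' := hφ.tendsto_atTop
  -- A half space `c ≤ ∫ f` that contains `S` has full measure: by the assumption on conditional
  -- measures, the limit of the averages of `f` is at least `c` almost everywhere.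
  have hmS : ∀ᵐ e : ProbabilityMeasure Ω ∂(m : Measure (ProbabilityMeasure Ω)), e ∈ S := by
    refine measure_null_of_locally_null _ fun e he => ?_
    have he' : toDual e ∉ toDual '' S := fun ⟨e', h1, h2⟩ => he (probToDual_injective h2 ▸ h1)
    obtain ⟨f, c, h1, h2⟩ := WeakDual.exists_lt_of_notMem hconv
      (isClosedEmbedding_probToDual.isClosedMap _ hS) he'
    refine ⟨{e' | evalInt f e' < c}, mem_nhdsWithin_of_mem_nhds
      ((isOpen_lt (evalInt f).continuous continuous_const).mem_nhds h1), ?_⟩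
    obtain ⟨h, hhm, hhL, hhinv, hht⟩ := exists_tendsto_avgFun Γ (x : Measure Ω) f
    have hge : ∀ᵐ y ∂(x : Measure Ω), c ≤ h y := by
      refine le_of_forall_cond Γ (x : Measure Ω) hhm hhL hhinv hht fun A hA hAinv hA0 => ?_
      have hη := hcond A hA hAinv ⟨_, ProbabilityTheory.cond_isProbabilityMeasure hA0⟩ hA0 rfl
      exact ⟨smulInvariantMeasure_of_mem (hSinv hη), h2 _ ⟨_, hη, rfl⟩⟩
    have habs := (tendsto_integral_abs_of_sq (fun n =>
      (memLp_boundedContinuous (ν := (x : Measure Ω)) (avgFun Γ n f)).sub hhL) hht).comp hφ'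
    have hu : Continuous fun t : ℝ => max (c - t) 0 := by fun_prop
    have hlim := hm f _ hu
    have hzero : ∫ e, max (c - evalInt f e) 0 ∂(m : Measure (ProbabilityMeasure Ω)) = 0 := by
      refine tendsto_nhds_unique hlim (squeeze_zero
        (fun n => integral_nonneg fun y => le_max_right _ _) (fun n => ?_) habs)
      refine integral_mono_of_nonneg (ae_of_all _ fun y => le_max_right _ _)
        (((avgFun Γ (φ n) f).integrable _).sub (hhL.integrable one_le_two)).abs ?_
      filter_upwards [hge] with y hy
      refine max_le ?_ (abs_nonneg _)
      simp only [Pi.sub_apply]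
      linarith [neg_abs_le (avgFun Γ (φ n) f y - h y)]
    have hint : Integrable (fun e => max (c - evalInt f e) 0)
        (m : Measure (ProbabilityMeasure Ω)) :=
      (((integrable_const c).sub ((evalInt f).integrable _)).sup (integrable_const 0))
    rw [integral_eq_zero_iff_of_nonneg (fun e => show 0 ≤ max _ _ from le_max_right _ _) hint]
      at hzero
    refine measure_mono_null (fun e' (he' : evalInt f e' < c) => ?_) hzero
    have : 0 < max (c - evalInt f e') 0 := lt_max_of_lt_left (sub_pos.2 he')
    exact this.ne'
  refine ⟨m, fun f => ?_, hmS, ?_⟩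
  · have h1 := hm f _ continuous_id
    simp only [id_eq, integral_avgFun] at h1
    exact (tendsto_nhds_unique h1 tendsto_const_nhds)
  · have hcount : ∀ᵐ e : ProbabilityMeasure Ω ∂(m : Measure (ProbabilityMeasure Ω)), ∀ i : ℕ,
        Tendsto (fun n => ∫ y, (avgFun Γ n (TopologicalSpace.denseSeq (Ω →ᵇ ℝ) i) y -
          ∫ z, TopologicalSpace.denseSeq (Ω →ᵇ ℝ) i z ∂(e : Measure Ω)) ^ 2
          ∂(e : Measure Ω)) atTop (𝓝 0) := by
      refine ae_all_iff.2 fun i => ?_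
      set f := TopologicalSpace.denseSeq (Ω →ᵇ ℝ) i
      obtain ⟨s, hs⟩ := exists_tendsto_integral_avgFun_sq Γ (x : Measure Ω) f
      -- The variance of the average under `e`, integrated over `m`, tends to `0`, and for each
      -- `e` it converges. By dominated convergence the limit is `0` almost everywhere.
      have hvar : ∀ e ∈ S, ∀ n, ∫ y, (avgFun Γ n f y - ∫ z, f z ∂(e : Measure Ω)) ^ 2
          ∂(e : Measure Ω) = evalInt (avgFun Γ n f ^ 2) e - evalInt f e ^ 2 := fun e he n => by
        have := smulInvariantMeasure_of_mem (hSinv he)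
        have h1 := integral_avgFun Γ (e : Measure Ω) n f
        set c := ∫ z, f z ∂(e : Measure Ω) with hc
        have i1 : Integrable (fun y => avgFun Γ n f y ^ 2) (e : Measure Ω) :=
          (avgFun Γ n f ^ 2).integrable _
        have i2 : Integrable (fun y => 2 * c * avgFun Γ n f y - c ^ 2) (e : Measure Ω) :=
          (((avgFun Γ n f).integrable _).const_mul _).sub (integrable_const _)
        have h2 : ∀ y, (avgFun Γ n f y - c) ^ 2 =
            avgFun Γ n f y ^ 2 - (2 * c * avgFun Γ n f y - c ^ 2) := fun y => by ring
        simp_rw [h2]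
        rw [integral_sub i1 i2, integral_sub (((avgFun Γ n f).integrable _).const_mul _)
          (integrable_const _), integral_const_mul, h1]
        simp only [integral_const, probReal_univ, one_smul, evalInt_apply, ← hc]
        have h3 : ∫ y, (avgFun Γ n f ^ 2) y ∂(e : Measure Ω) =
          ∫ y, avgFun Γ n f y ^ 2 ∂(e : Measure Ω) := rfl
        rw [h3]
        ring
      have hlimm : Tendsto (fun n => ∫ e, (evalInt (avgFun Γ n f ^ 2) e - evalInt f e ^ 2)
          ∂(m : Measure (ProbabilityMeasure Ω))) atTop (𝓝 0) := by
        have hbar : ∀ g, ∫ e, evalInt g e ∂(m : Measure (ProbabilityMeasure Ω)) =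
            ∫ y, g y ∂(x : Measure Ω) := fun g => by
          have h1 := hm g _ continuous_id
          simp only [id_eq, integral_avgFun] at h1
          exact (tendsto_nhds_unique h1 tendsto_const_nhds)
        have hsq : ∫ e, evalInt f e ^ 2 ∂(m : Measure (ProbabilityMeasure Ω)) = s :=
          tendsto_nhds_unique (hm f (fun t => t ^ 2) (by fun_prop)) (hs.comp hφ')
        have hi : Integrable (fun e => evalInt f e ^ 2) (m : Measure (ProbabilityMeasure Ω)) :=
          (evalInt f ^ 2).integrable _
        simp_rw [integral_sub ((evalInt _).integrable _) hi, hsq, hbar]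
        simpa using hs.sub_const s
      have hconvg : ∀ e ∈ S, ∃ l, Tendsto
          (fun n => evalInt (avgFun Γ n f ^ 2) e - evalInt f e ^ 2) atTop (𝓝 l) := fun e he => by
        have := smulInvariantMeasure_of_mem (hSinv he)
        obtain ⟨l, hl⟩ := exists_tendsto_integral_avgFun_sq Γ (e : Measure Ω) f
        exact ⟨_, hl.sub_const _⟩
      set v : ProbabilityMeasure Ω → ℝ := fun e =>
        limUnder atTop fun n => evalInt (avgFun Γ n f ^ 2) e - evalInt f e ^ 2
      have hv : ∀ᵐ e : ProbabilityMeasure Ω ∂(m : Measure (ProbabilityMeasure Ω)), Tendsto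
          (fun n => evalInt (avgFun Γ n f ^ 2) e - evalInt f e ^ 2) atTop (𝓝 (v e)) :=
        hmS.mono fun e he => tendsto_nhds_limUnder (hconvg e he)
      have hmeas : ∀ n, AEStronglyMeasurable
          (fun e => evalInt (avgFun Γ n f ^ 2) e - evalInt f e ^ 2)
          (m : Measure (ProbabilityMeasure Ω)) := fun n =>
        (evalInt (avgFun Γ n f ^ 2) - evalInt f ^ 2).continuous.measurable.aestronglyMeasurable
      have hbd : ∀ n, ∀ e, ‖evalInt (avgFun Γ n f ^ 2) e - evalInt f e ^ 2‖ ≤ 2 * ‖f‖ ^ 2 :=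
        fun n e => by
          have h1 : ‖evalInt (avgFun Γ n f ^ 2) e‖ ≤ ‖f‖ ^ 2 :=
            ((avgFun Γ n f ^ 2).norm_integral_le_norm _).trans
              ((norm_pow_le' _ two_pos).trans (pow_le_pow_left₀ (norm_nonneg _)
                (norm_avgFun_apply_le Γ n f) 2))
          have h2 : ‖evalInt f e ^ 2‖ ≤ ‖f‖ ^ 2 := by
            rw [norm_pow]
            exact pow_le_pow_left₀ (norm_nonneg _) (f.norm_integral_le_norm _) 2
          linarith [norm_sub_le (evalInt (avgFun Γ n f ^ 2) e) (evalInt f e ^ 2)]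
      have hdct := tendsto_integral_of_dominated_convergence (fun _ => 2 * ‖f‖ ^ 2) hmeas
        (integrable_const _) (fun n => ae_of_all _ (hbd n)) hv
      have hv0 : ∫ e, v e ∂(m : Measure (ProbabilityMeasure Ω)) = 0 :=
        tendsto_nhds_unique hdct hlimm
      have hvnn : 0 ≤ᵐ[(m : Measure (ProbabilityMeasure Ω))] v := by
        filter_upwards [hv, hmS] with e h1 h2
        refine ge_of_tendsto' h1 fun n => ?_
        rw [← hvar e h2 n]
        exact integral_nonneg fun y => sq_nonneg _
      have hvi : Integrable v (m : Measure (ProbabilityMeasure Ω)) := by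
        refine Integrable.of_bound (aestronglyMeasurable_of_tendsto_ae atTop hmeas hv)
          (2 * ‖f‖ ^ 2) ?_
        filter_upwards [hv] with e h1
        exact le_of_tendsto' h1.norm fun n => hbd n e
      rw [integral_eq_zero_iff_of_nonneg_ae hvnn hvi] at hv0
      filter_upwards [hv0, hv, hmS] with e h1 h2 h3
      rw [h1] at h2
      exact h2.congr fun n => (hvar e h3 n).symm
    filter_upwards [hcount] with e he
    rintro _ ⟨i, rfl⟩
    exact he i

end ErgodicDecompositionExistence

/-! ### Asymptotically invariant sets in an ergodic action -/

/-- Weak convergence of a bounded sequence to `0` can be tested on a set `D` with trivial orthogonal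
complement. -/
theorem tendsto_inner_of_dense {H : Type*} [NormedAddCommGroup H] [InnerProductSpace ℝ H]
    [CompleteSpace H] {c : ℕ → H} {M : ℝ} (hc : ∀ k, ‖c k‖ ≤ M) {D : Set H}
    (hD : ∀ d ∈ D, Tendsto (fun k => inner ℝ (c k) d) atTop (𝓝 0))
    (hD' : ∀ w, (∀ d ∈ D, inner ℝ d w = 0) → w = 0) (v : H) :
    Tendsto (fun k => inner ℝ (c k) v) atTop (𝓝 0) := by
  let Z : Submodule ℝ H :=
    { carrier := {v | Tendsto (fun k => inner ℝ (c k) v) atTop (𝓝 0)}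
      zero_mem' := by simp
      add_mem' := fun {a b} ha hb => by
        simpa [inner_add_right] using Tendsto.add ha hb
      smul_mem' := fun r a ha => by
        simpa [inner_smul_right] using Tendsto.const_mul r ha }
  have hM : 0 ≤ M := (norm_nonneg _).trans (hc 0)
  have hcl : IsClosed (Z : Set H) := by
    refine isClosed_of_closure_subset fun a ha => ?_
    refine Metric.tendsto_atTop.2 fun ε hε => ?_
    obtain ⟨b, hb, hab⟩ := Metric.mem_closure_iff.1 ha (ε / (2 * (M + 1))) (by positivity)
    obtain ⟨N, hN⟩ := Metric.tendsto_atTop.1 hb (ε / 2) (by positivity)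
    refine ⟨N, fun n hn => ?_⟩
    have h1 := hN n hn
    rw [dist_zero_right, Real.norm_eq_abs] at h1 ⊢
    have h2 : |inner ℝ (c n) (a - b)| ≤ ε / 2 := by
      refine (abs_real_inner_le_norm _ _).trans ?_
      rw [dist_eq_norm] at hab
      calc ‖c n‖ * ‖a - b‖ ≤ (M + 1) * (ε / (2 * (M + 1))) := by
            gcongr
            exact (hc n).trans (by linarith)
        _ = ε / 2 := by field_simp
    have h3 : inner ℝ (c n) a = inner ℝ (c n) (a - b) + inner ℝ (c n) b := by
      rw [← inner_add_right, sub_add_cancel]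
    rw [h3]
    linarith [abs_add_le (inner ℝ (c n) (a - b)) (inner ℝ (c n) b)]
  have hbot : Zᗮ = ⊥ := (Submodule.eq_bot_iff _).2 fun w hw =>
    hD' w fun d hd => Submodule.inner_right_of_mem_orthogonal (hD d hd : d ∈ Z) hw
  have htop : Z = ⊤ := by
    rw [← hcl.submodule_topologicalClosure_eq]
    exact Submodule.topologicalClosure_eq_top_iff.2 hbot
  have : v ∈ Z := htop ▸ Submodule.mem_top
  exact this

section AsymptoticallyInvariant

variable {Γ X : Type*} [Group Γ] [MulAction Γ X]

theorem image_smul_eq_preimage (γ : Γ) (B : Set X) :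
    (fun x => γ • x) '' B = (fun x => γ⁻¹ • x) ⁻¹' B :=
  congrFun (Set.image_eq_preimage_of_inverse (inv_smul_smul γ) (smul_inv_smul γ)) B

variable [MeasurableSpace X] [MeasurableConstSMul Γ X]

theorem measurableSet_image_smul (γ : Γ) {B : Set X} (hB : MeasurableSet B) :
    MeasurableSet ((fun x => γ • x) '' B) := by
  rw [image_smul_eq_preimage]
  exact measurable_const_smul γ⁻¹ hB

variable {μ : Measure X} [IsProbabilityMeasure μ]

/-- In an ergodic action, the indicator functions of asymptotically invariant sets of measure
tending to `p` converge weakly in `L²` to the constant `p`. -/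
theorem tendsto_setIntegral_of_isAsymptoticallyInvariant [ErgodicSMul Γ X μ] {B : ℕ → Set X}
    (hB : IsAsymptoticallyInvariant Γ μ B) {p : ℝ}
    (hp : Tendsto (fun k => μ.real (B k)) atTop (𝓝 p)) {g : X → ℝ} (hg : MemLp g 2 μ) :
    Tendsto (fun k => ∫ x in B k, g x ∂μ) atTop (𝓝 (p * ∫ x, g x ∂μ)) := by
  obtain ⟨hBm, hBi⟩ := hB
  let b : ℕ → Lp ℝ 2 μ := fun k => indicatorConstLp 2 (hBm k) (measure_ne_top μ _) 1
  let one : Lp ℝ 2 μ := indicatorConstLp 2 MeasurableSet.univ (measure_ne_top μ _) 1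
  have hb : ∀ k (v : Lp ℝ 2 μ), inner ℝ (b k) v = ∫ x in B k, v x ∂μ := fun k v =>
    L2.inner_indicatorConstLp_one (hBm k) (measure_ne_top μ _) v
  have hone : ∀ v : Lp ℝ 2 μ, inner ℝ one v = ∫ x, v x ∂μ := fun v => by
    rw [L2.inner_indicatorConstLp_one, setIntegral_univ]
  have hint : ∀ v : Lp ℝ 2 μ, Integrable v μ := fun v => (Lp.memLp v).integrable one_le_two
  have hnorm : ∀ k, ‖b k - p • one‖ ≤ 1 + |p| := fun k => by
    have h1 : ∀ {s : Set X} (hs : MeasurableSet s),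
        ‖(indicatorConstLp 2 hs (measure_ne_top μ _) 1 : Lp ℝ 2 μ)‖ ≤ 1 := fun {s} hs => by
      refine norm_indicatorConstLp_le.trans ?_
      rw [norm_one, one_mul]
      exact Real.rpow_le_one measureReal_nonneg measureReal_le_one (by positivity)
    refine (norm_sub_le _ _).trans (add_le_add (h1 _) ?_)
    rw [norm_smul, Real.norm_eq_abs]
    exact mul_le_of_le_one_right (abs_nonneg p) (h1 _)
  have hdiff : ∀ γ : Γ, ∀ v : Lp ℝ 2 μ, inner ℝ one (v - koopman μ γ v) = 0 := fun γ v => by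
    have h1 : ∫ x, koopman μ γ v x ∂μ = ∫ x, v x ∂μ := by
      rw [integral_congr_ae (koopman_ae_eq μ γ v)]
      exact (measurePreserving_smul γ μ).integral_comp (measurableEmbedding_const_smul γ) v
    rw [inner_sub_right, hone, hone, h1, sub_self]
  -- By ergodicity only `0` is orthogonal to the constants and the coboundaries `v - γ v`.
  have key := tendsto_inner_of_dense hnorm
    (D := {one} ∪ {d | ∃ (γ : Γ) (v : Lp ℝ 2 μ), d = v - koopman μ γ v}) ?_ ?_
  · have h1 := key (hg.toLp g)
    have h2 : ∀ k, inner ℝ (b k - p • one) (hg.toLp g) =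
        (∫ x in B k, g x ∂μ) - p * ∫ x, g x ∂μ := fun k => by
      rw [inner_sub_left, real_inner_smul_left, hb, hone,
        integral_congr_ae (hg.coeFn_toLp), integral_congr_ae (ae_restrict_of_ae hg.coeFn_toLp)]
    simp_rw [h2] at h1
    simpa using h1.add_const (p * ∫ x, g x ∂μ)
  · rintro d (rfl | ⟨γ, v, rfl⟩)
    · have h1 : ∀ k, inner ℝ (b k - p • one) one = μ.real (B k) - p := fun k => by
        have h2 : inner ℝ one (b k) = μ.real (B k) := by
          rw [hone, integral_indicatorConstLp]; simp
        have h3 : inner ℝ one one = (1 : ℝ) := by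
          rw [hone, integral_indicatorConstLp]; simp
        rw [inner_sub_left, real_inner_smul_left, real_inner_comm, h2, h3, mul_one]
      simp_rw [h1]
      simpa using hp.sub_const p
    · have h0 : Tendsto (fun k => μ (symmDiff (B k) ((fun x => γ • x) '' B k))) atTop (𝓝 0) := by
        rw [← ENNReal.tendsto_toReal_iff (fun k => measure_ne_top _ _) ENNReal.zero_ne_top]
        exact hBi γ
      have t1 : Tendsto (fun k => ∫ x in B k \ ((fun x => γ • x) '' B k), v x ∂μ) atTop (𝓝 0) :=
        (hint v).tendsto_setIntegral_nhds_zero (tendsto_of_tendsto_of_tendsto_of_le_of_le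
          tendsto_const_nhds h0 (fun _ => zero_le) fun k => measure_mono subset_union_left)
      have t2 : Tendsto (fun k => ∫ x in ((fun x => γ • x) '' B k) \ B k, v x ∂μ) atTop (𝓝 0) :=
        (hint v).tendsto_setIntegral_nhds_zero (tendsto_of_tendsto_of_tendsto_of_le_of_le
          tendsto_const_nhds h0 (fun _ => zero_le) fun k => measure_mono subset_union_right)
      have t3 := t1.sub t2
      rw [sub_zero] at t3
      refine t3.congr fun k => ?_
      have hBγ := measurableSet_image_smul γ (hBm k)
      rw [inner_sub_left, real_inner_smul_left, hdiff, mul_zero, sub_zero, inner_sub_right, hb, hb]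
      have h4 : ∫ x in B k, koopman μ γ v x ∂μ = ∫ x in (fun x => γ • x) '' B k, v x ∂μ := by
        rw [integral_congr_ae (ae_restrict_of_ae (koopman_ae_eq μ γ v)),
          ← (measurePreserving_smul γ μ).setIntegral_preimage_emb
            (measurableEmbedding_const_smul γ) v,
          preimage_image_eq _ (MulAction.injective γ)]
      have h5 := integral_inter_add_sdiff hBγ (hint v).integrableOn (s := B k)
      have h6 := integral_inter_add_sdiff (hBm k) (hint v).integrableOn
        (s := (fun x => γ • x) '' B k)
      rw [inter_comm] at h6
      rw [h4, ← h5, ← h6]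
      ring
  · intro w hw
    have hfix : ∀ γ : Γ, koopman μ γ w = w := fun γ => by
      have h1 := hw _ (Or.inr ⟨γ, w, rfl⟩)
      rw [inner_sub_left, sub_eq_zero, real_inner_self_eq_norm_sq] at h1
      exact eq_of_norm_le_re_inner_eq_norm_sq (𝕜 := ℝ) (norm_koopman_apply μ γ w).le h1.symm
    obtain ⟨c, hc⟩ := ae_eq_const_of_invariant (Γ := Γ) (Lp.aestronglyMeasurable w) fun γ => by
      have := koopman_ae_eq μ γ w
      rw [hfix γ] at this
      exact this.symm
    have h1 : inner ℝ one w = (0 : ℝ) := hw _ (Or.inl rfl)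
    rw [hone, integral_congr_ae hc] at h1
    simp only [Function.const_apply, integral_const, probReal_univ, one_smul] at h1
    refine Lp.ext ((hc.trans ?_).trans (Lp.coeFn_zero ℝ 2 μ).symm)
    rw [h1]
    exact EventuallyEq.rfl

end AsymptoticallyInvariant

/-! ### Factor maps into the shift -/

section Shift

/-- A continuous function on the product depends, up to `ε`, on finitely many coordinates only. -/
theorem exists_finset_abs_sub_lt {Γ C : Type*} [TopologicalSpace C] [CompactSpace C] [T2Space C]
    (f : (Γ → C) →ᵇ ℝ) {ε : ℝ} (hε : 0 < ε) :
    ∃ F : Finset Γ, ∀ y z : Γ → C, (∀ γ ∈ F, y γ = z γ) → |f y - f z| < ε := by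
  let : UniformSpace C := uniformSpaceOfCompactR1
  have hu := CompactSpace.uniformContinuous_of_continuous f.continuous
  have h1 := hu (Metric.dist_mem_uniformity hε)
  rw [Filter.mem_map, Pi.uniformity, Filter.mem_iInf] at h1
  obtain ⟨I, hI, V, hV, hVeq⟩ := h1
  refine ⟨hI.toFinset, fun y z hyz => ?_⟩
  have : (y, z) ∈ ⋂ i, V i := by
    refine mem_iInter.2 fun i => ?_
    obtain ⟨U, hU, hUV⟩ := Filter.mem_comap.1 (hV i)
    refine hUV ?_
    change (y i, z i) ∈ U
    rw [hyz i (hI.mem_toFinset.2 i.2)]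
    exact refl_mem_uniformity hU
  rw [← hVeq] at this
  exact this

variable {Γ C : Type*} [Group Γ]

/-- The shift action of `Γ` on `Γ → C`. -/
@[reducible]
def shiftMulAction : MulAction Γ (Γ → C) where
  smul := shift
  one_smul x := by funext f; simp [shift, HSMul.hSMul]
  mul_smul a b x := by funext f; simp [shift, HSMul.hSMul, mul_assoc]

attribute [local instance] shiftMulAction

theorem shift_smul_apply (γ : Γ) (x : Γ → C) (f : Γ) : (γ • x) f = x (γ⁻¹ * f) := rfl

theorem continuousConstSMul_shift [TopologicalSpace C] : ContinuousConstSMul Γ (Γ → C) :=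
  ⟨fun γ => continuous_pi fun f => continuous_apply (γ⁻¹ * f)⟩

variable {X : Type*} [MulAction Γ X]

/-- The equivariant map `X → C^Γ` with coordinate `φ` at the identity. -/
def factorMap (φ : X → C) : X → Γ → C := fun x γ => φ (γ⁻¹ • x)

theorem factorMap_smul (φ : X → C) (γ : Γ) (x : X) :
    (factorMap φ (γ • x) : Γ → C) = γ • factorMap φ x := by
  funext f
  simp [factorMap, shift_smul_apply, mul_smul]

theorem eq_factorMap {Φ : X → Γ → C} (h : ∀ (γ : Γ) (x : X), Φ (γ • x) = shift γ (Φ x)) :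
    Φ = factorMap fun x => Φ x 1 := by
  funext x f
  simp [factorMap, h, shift]

variable [MeasurableSpace X] [MeasurableConstSMul Γ X] [MeasurableSpace C]

theorem measurable_factorMap {φ : X → C} (hφ : Measurable φ) :
    Measurable (factorMap φ : X → Γ → C) :=
  measurable_pi_lambda _ fun γ => hφ.comp (measurable_const_smul γ⁻¹)

end Shift

/-! ### Gluing factor maps -/

section FactorMeasure

variable {Γ : Type*} [Group Γ] {C : Type*} [MeasurableSpace C]
  {X : Type*} [MeasurableSpace X] [MulAction Γ X] [MeasurableConstSMul Γ X]
  {μ : Measure X} [IsProbabilityMeasure μ]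

variable (μ) in
/-- The push-forward of `μ` under `factorMap φ`. -/
noncomputable def factorMeasure {φ : X → C} (hφ : Measurable φ) : ProbabilityMeasure (Γ → C) :=
  ⟨μ.map (factorMap φ), Measure.isProbabilityMeasure_map (measurable_factorMap hφ).aemeasurable⟩

theorem mem_factorMeasures_iff {ν : ProbabilityMeasure (Γ → C)} :
    ν ∈ factorMeasures Γ C μ ↔ ∃ (φ : X → C) (hφ : Measurable φ), ν = factorMeasure μ hφ := by
  constructor
  · rintro ⟨Φ, hΦ, heq, hν⟩
    have hφ : Measurable fun x => Φ x 1 := (measurable_pi_apply 1).comp hΦ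
    refine ⟨_, hφ, ProbabilityMeasure.toMeasure_injective ?_⟩
    rw [hν]
    exact congrArg (Measure.map · μ) (eq_factorMap heq)
  · rintro ⟨φ, hφ, rfl⟩
    exact ⟨factorMap φ, measurable_factorMap hφ, factorMap_smul φ, rfl⟩

theorem factorMeasure_mem {φ : X → C} (hφ : Measurable φ) :
    (factorMeasure μ hφ : ProbabilityMeasure (Γ → C)) ∈ factorMeasures Γ C μ :=
  mem_factorMeasures_iff.2 ⟨φ, hφ, rfl⟩

end FactorMeasure

section Gluing

attribute [local instance] shiftMulAction continuousConstSMul_shift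

variable {Γ : Type*} [Group Γ] [Countable Γ] {C : Type*} [TopologicalSpace C]
  [SecondCountableTopology C] [MeasurableSpace C] [BorelSpace C]
  {X : Type*} [MeasurableSpace X] [MulAction Γ X] [MeasurableConstSMul Γ X]
  {μ : Measure X} [IsProbabilityMeasure μ]

theorem integrable_comp_factorMap (f : (Γ → C) →ᵇ ℝ) {φ : X → C} (hφ : Measurable φ) :
    Integrable (fun x => f (factorMap φ x)) μ :=
  Integrable.of_bound (f.continuous.measurable.comp
    (measurable_factorMap hφ)).aestronglyMeasurable ‖f‖ (ae_of_all _ fun _ => f.norm_coe_le_norm _)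

/-- If `u = v` on `S`, then `factorMap u x` and `factorMap v x` agree in the coordinates in `F` unless
`x` is in `S` but not in `γ • S` for some `γ ∈ F`. -/
theorem abs_setIntegral_factorMap_sub_le (f : (Γ → C) →ᵇ ℝ) {u v : X → C} (hu : Measurable u)
    (hv : Measurable v) {S : Set X} (hS : MeasurableSet S) (huv : ∀ x ∈ S, u x = v x)
    {ε : ℝ} (hε : 0 ≤ ε) {F : Finset Γ}
    (hF : ∀ y z : Γ → C, (∀ γ ∈ F, y γ = z γ) → |f y - f z| < ε) :
    |(∫ x in S, f (factorMap u x) ∂μ) - ∫ x in S, f (factorMap v x) ∂μ| ≤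
      ε + 2 * ‖f‖ * ∑ γ ∈ F, μ.real (S \ ((fun x => γ • x) '' S)) := by
  have hbad : ∀ γ : Γ, MeasurableSet (S \ ((fun x => γ • x) '' S)) := fun γ =>
    hS.diff (measurableSet_image_smul γ hS)
  let R : X → ℝ := fun x => ε + 2 * ‖f‖ * ∑ γ ∈ F, (S \ ((fun x => γ • x) '' S)).indicator 1 x
  have hind : ∀ γ : Γ, Integrable ((S \ ((fun x => γ • x) '' S)).indicator (1 : X → ℝ)) μ :=
    fun γ => (integrable_const (1 : ℝ)).indicator (hbad γ)
  have hsum : Integrable (fun x => ∑ γ ∈ F, (S \ ((fun x => γ • x) '' S)).indicator (1 : X → ℝ) x)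
      μ := integrable_finsetSum _ fun γ _ => hind γ
  have hR : Integrable R μ := (integrable_const ε).add (hsum.const_mul _)
  have hnn : ∀ x, 0 ≤ ∑ γ ∈ F, (S \ ((fun x => γ • x) '' S)).indicator (1 : X → ℝ) x := fun x =>
    Finset.sum_nonneg fun γ _ => indicator_nonneg (fun _ _ => zero_le_one) _
  have hpt : ∀ x ∈ S, |f (factorMap u x) - f (factorMap v x)| ≤ R x := by
    intro x hx
    by_cases h : ∀ γ ∈ F, x ∈ (fun x => γ • x) '' S
    · refine (hF _ _ fun γ hγ => ?_).le.trans
        (le_add_of_nonneg_right (mul_nonneg (by positivity) (hnn x)))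
      have h1 := h γ hγ
      rw [image_smul_eq_preimage] at h1
      exact huv _ h1
    · push Not at h
      obtain ⟨γ, hγ, hx'⟩ := h
      have h1 : (1 : ℝ) ≤ ∑ γ ∈ F, (S \ ((fun x => γ • x) '' S)).indicator (1 : X → ℝ) x := by
        refine le_trans ?_ (Finset.single_le_sum
          (fun γ _ => indicator_nonneg (fun _ _ => zero_le_one) _) hγ)
        rw [indicator_of_mem (show x ∈ S \ _ from ⟨hx, hx'⟩)]
      calc |f (factorMap u x) - f (factorMap v x)|
          ≤ |f (factorMap u x)| + |f (factorMap v x)| := abs_sub _ _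
        _ ≤ ‖f‖ + ‖f‖ := add_le_add (f.norm_coe_le_norm _) (f.norm_coe_le_norm _)
        _ = 2 * ‖f‖ * 1 := by ring
        _ ≤ 2 * ‖f‖ * ∑ γ ∈ F, (S \ ((fun x => γ • x) '' S)).indicator (1 : X → ℝ) x := by gcongr
        _ ≤ R x := le_add_of_nonneg_left hε
  have iu := integrable_comp_factorMap (μ := μ) f hu
  have iv := integrable_comp_factorMap (μ := μ) f hv
  have hRnn : ∀ x, 0 ≤ R x := fun x => add_nonneg hε (mul_nonneg (by positivity) (hnn x))
  rw [← integral_sub iu.integrableOn iv.integrableOn]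
  calc |∫ x in S, (f (factorMap u x) - f (factorMap v x)) ∂μ|
      ≤ ∫ x in S, |f (factorMap u x) - f (factorMap v x)| ∂μ := abs_integral_le_integral_abs
    _ ≤ ∫ x in S, R x ∂μ :=
        setIntegral_mono_on (iu.sub iv).abs.integrableOn hR.integrableOn hS hpt
    _ ≤ ∫ x, R x ∂μ := setIntegral_le_integral hR (ae_of_all _ hRnn)
    _ = ε + 2 * ‖f‖ * ∑ γ ∈ F, μ.real (S \ ((fun x => γ • x) '' S)) := by
        rw [integral_add (integrable_const ε) (hsum.const_mul _), integral_const_mul,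
          integral_finsetSum _ fun γ _ => hind γ]
        simp [integral_indicator_one, hbad]

theorem integral_factorMeasure {φ : X → C} (hφ : Measurable φ) (f : (Γ → C) →ᵇ ℝ) :
    ∫ y, f y ∂(factorMeasure (Γ := Γ) μ hφ : Measure (Γ → C)) = ∫ x, f (factorMap φ x) ∂μ :=
  integral_map (measurable_factorMap hφ).aemeasurable f.continuous.measurable.aestronglyMeasurable

variable [CompactSpace C] [T2Space C]

/-- Asymptotic invariance makes gluing harmless: maps that agree with `φ k` on asymptotically
invariant sets have asymptotically the same factor maps there. -/
theorem tendsto_setIntegral_factorMap_sub (f : (Γ → C) →ᵇ ℝ) {u v : ℕ → X → C}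
    (hu : ∀ k, Measurable (u k)) (hv : ∀ k, Measurable (v k)) {S : ℕ → Set X}
    (hS : ∀ k, MeasurableSet (S k)) (huv : ∀ k, ∀ x ∈ S k, u k x = v k x)
    (hinv : ∀ γ : Γ, Tendsto (fun k => μ.real (S k \ ((fun x => γ • x) '' S k))) atTop (𝓝 0)) :
    Tendsto (fun k => (∫ x in S k, f (factorMap (u k) x) ∂μ) -
      ∫ x in S k, f (factorMap (v k) x) ∂μ) atTop (𝓝 0) := by
  refine Metric.tendsto_atTop.2 fun ε hε => ?_
  obtain ⟨F, hF⟩ := exists_finset_abs_sub_lt f (half_pos hε)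
  have h1 : Tendsto (fun k => ε / 2 + 2 * ‖f‖ * ∑ γ ∈ F, μ.real (S k \ ((fun x => γ • x) '' S k)))
      atTop (𝓝 (ε / 2)) := by
    have := ((tendsto_finsetSum F fun γ _ => hinv γ).const_mul (2 * ‖f‖)).const_add (ε / 2)
    simpa using this
  obtain ⟨N, hN⟩ := eventually_atTop.1 (h1.eventually_lt_const (half_lt_self hε))
  refine ⟨N, fun k hk => ?_⟩
  rw [dist_zero_right, Real.norm_eq_abs]
  exact (abs_setIntegral_factorMap_sub_le f (hu k) (hv k) (hS k) (huv k) (half_pos hε).le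
    hF).trans_lt (hN k hk)

/-- Let `φ k` have asymptotic distribution `η` on asymptotically invariant sets `B k` of measure
tending to `p`. Use `φ k` on `B k` and a fixed map `ψ` elsewhere: in the limit `B k` is independent
of `ψ`, so the factor measures converge to a convex combination of `η` and the factor measure
of `ψ`. -/
theorem smul_add_smul_mem_of_isAsymptoticallyInvariant [ErgodicSMul Γ X μ] {B : ℕ → Set X}
    (hB : IsAsymptoticallyInvariant Γ μ B) {p : ℝ}
    (hp : Tendsto (fun k => μ.real (B k)) atTop (𝓝 p)) {φ : ℕ → X → C}
    (hφ : ∀ k, Measurable (φ k)) {η : ProbabilityMeasure (Γ → C)}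
    (hη : ∀ f : (Γ → C) →ᵇ ℝ, Tendsto (fun k => ∫ x in B k, f (factorMap (φ k) x) ∂μ) atTop
      (𝓝 (p * ∫ y, f y ∂(η : Measure (Γ → C))))) :
    ∀ y ∈ toDual '' weakClass Γ C μ,
      p • toDual η + (1 - p) • y ∈ toDual '' weakClass Γ C μ := by
  classical
  have hp0 : 0 ≤ p := ge_of_tendsto' hp fun k => measureReal_nonneg
  have hp1 : p ≤ 1 := le_of_tendsto' hp fun k => measureReal_le_one
  have hcl : toDual '' weakClass Γ C μ = closure (toDual '' factorMeasures Γ C μ) :=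
    (isClosedEmbedding_probToDual.closure_image_eq _).symm
  have hfac : MapsTo (fun y => p • toDual η + (1 - p) • y) (toDual '' factorMeasures Γ C μ)
      (toDual '' weakClass Γ C μ) := by
    rintro _ ⟨κ, hκ, rfl⟩
    obtain ⟨ψ, hψ, rfl⟩ := mem_factorMeasures_iff.1 hκ
    obtain ⟨ξ, hξ⟩ := exists_toDual_eq_convexComb η (factorMeasure μ hψ) hp0 (sub_nonneg.2 hp1)
      (by ring)
    refine ⟨ξ, ?_, hξ⟩
    have hΨ : ∀ k, Measurable ((B k).piecewise (φ k) ψ) := fun k => (hφ k).piecewise (hB.1 k) hψ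
    refine mem_closure_of_tendsto (f := fun k => factorMeasure μ (hΨ k)) (b := atTop) ?_
      (Eventually.of_forall fun k => factorMeasure_mem (hΨ k))
    refine ProbabilityMeasure.tendsto_iff_forall_integral_tendsto.2 fun f => ?_
    have hlim : ∫ y, f y ∂(ξ : Measure (Γ → C)) = p * (∫ y, f y ∂(η : Measure (Γ → C))) +
        (1 - p) * ∫ x, f (factorMap ψ x) ∂μ := by
      rw [← integral_factorMeasure hψ f]
      exact DFunLike.congr_fun hξ f
    have hle : ∀ (γ : Γ) (S T : ℕ → Set X), (∀ k, S k \ T k ⊆ symmDiff (B k)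
        ((fun x => γ • x) '' B k)) → Tendsto (fun k => μ.real (S k \ T k)) atTop (𝓝 0) :=
      fun γ S T h => squeeze_zero (fun k => measureReal_nonneg)
        (fun k => measureReal_mono (h k)) (hB.2 γ)
    have t1 := tendsto_setIntegral_factorMap_sub (μ := μ) f hΨ hφ hB.1
      (fun k x hx => piecewise_eq_of_mem _ _ _ hx)
      fun γ => hle γ _ _ fun k => subset_union_left
    have t2 := tendsto_setIntegral_factorMap_sub (μ := μ) f hΨ (fun _ => hψ)
      (fun k => (hB.1 k).compl) (fun k x hx => piecewise_eq_of_notMem _ _ _ hx)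
      fun γ => hle γ _ _ fun k => by
        rw [image_compl_eq (MulAction.bijective γ)]
        exact fun x hx => Or.inr ⟨not_not.1 hx.2, hx.1⟩
    have iψ := integrable_comp_factorMap (μ := μ) f hψ
    have t3 := tendsto_setIntegral_of_isAsymptoticallyInvariant hB hp
      (MemLp.of_bound iψ.aestronglyMeasurable ‖f‖ (ae_of_all _ fun x => f.norm_coe_le_norm _))
    have t4 := ((t1.add (hη f)).add t2).add (t3.const_sub (∫ x, f (factorMap ψ x) ∂μ))
    rw [hlim]
    refine Tendsto.congr' (Eventually.of_forall fun k => ?_) (t4.trans (le_of_eq ?_))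
    · change _ = ∫ y, f y ∂(factorMeasure (Γ := Γ) μ (hΨ k) : Measure (Γ → C))
      have h1 := integral_add_compl (hB.1 k) (integrable_comp_factorMap (μ := μ) f (hΨ k))
      have h2 := integral_add_compl (hB.1 k) iψ
      rw [integral_factorMeasure]
      linarith
    · congr 1
      ring
  intro y hy
  rw [hcl] at hy
  have hcont : Continuous fun y : WeakDual ℝ ((Γ → C) →ᵇ ℝ) => p • toDual η + (1 - p) • y := by
    fun_prop
  have hWcl : IsClosed (toDual '' weakClass Γ C μ) := hcl ▸ isClosed_closure
  rw [← hWcl.closure_eq]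
  exact map_mem_closure
    (f := fun y : WeakDual ℝ ((Γ → C) →ᵇ ℝ) => p • toDual η + (1 - p) • y) hcont hy hfac

end Gluing

/-! ### Closed sets stable under convex combinations -/

section ClosedConvex

variable {E : Type*} [AddCommGroup E] [Module ℝ E] [TopologicalSpace E] [IsTopologicalAddGroup E]
  [ContinuousSMul ℝ E] {K : Set E}

/-- A closed set which is mapped into itself by a contraction towards `e` contains `e`. -/
theorem IsClosed.mem_of_smul_add_smul_mem (hK : IsClosed K) {e : E} {p : ℝ} (hp0 : 0 < p)
    (hp1 : p ≤ 1) (h : ∀ y ∈ K, p • e + (1 - p) • y ∈ K) (hne : K.Nonempty) : e ∈ K := by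
  obtain ⟨y, hy⟩ := hne
  have h1 : ∀ n : ℕ, e + (1 - p) ^ n • (y - e) ∈ K := fun n => by
    induction n with
    | zero => simpa using hy
    | succ n ih =>
      convert h _ ih using 1
      rw [pow_succ]
      module
  have h2 : Tendsto (fun n : ℕ => e + (1 - p) ^ n • (y - e)) atTop (𝓝 (e + (0 : ℝ) • (y - e))) :=
    ((tendsto_pow_atTop_nhds_zero_of_lt_one (by linarith) (by linarith)).smul_const _).const_add _
  rw [zero_smul, add_zero] at h2
  exact hK.mem_of_tendsto h2 (Eventually.of_forall h1)

/-- A closed set that contains the convex combinations of its points with one fixed ratio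
is convex. -/
theorem IsClosed.convex_of_smul_add_smul_mem (hK : IsClosed K) {p : ℝ} (hp0 : 0 < p) (hp1 : p < 1)
    (h : ∀ y ∈ K, ∀ z ∈ K, p • y + (1 - p) • z ∈ K) : Convex ℝ K := by
  refine convex_iff_forall_pos.2 fun y hy z hz a b ha hb hab => ?_
  let g : ℝ → E := fun t => t • y + (1 - t) • z
  have hg : Continuous g := by fun_prop
  have hgcl : IsClosed (g ⁻¹' K) := hK.preimage hg
  have hb' : b = 1 - a := by linarith
  subst hb'
  by_contra hcon
  have hlo : (g ⁻¹' K ∩ Icc 0 a).Nonempty := ⟨0, by simpa [g] using hz, le_rfl, ha.le⟩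
  have hhi : (g ⁻¹' K ∩ Icc a 1).Nonempty := ⟨1, by simpa [g] using hy, by linarith, le_rfl⟩
  -- The gap `(s, t)` of `g ⁻¹' K` around `a` contains the point that divides it in the ratio `p`,
  -- which belongs to `g ⁻¹' K`.
  obtain ⟨s, ⟨hsK, hs0, hsa⟩, hsmax⟩ := (isCompact_Icc.inter_left hgcl).exists_isGreatest hlo
  obtain ⟨t, ⟨htK, hta, ht1⟩, htmin⟩ := (isCompact_Icc.inter_left hgcl).exists_isLeast hhi
  have hsa' : s < a := lt_of_le_of_ne hsa fun h => hcon (h ▸ hsK)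
  have hta' : a < t := lt_of_le_of_ne hta fun h => hcon (h ▸ htK)
  have hmid : p * t + (1 - p) * s ∈ g ⁻¹' K := by
    have := h _ htK _ hsK
    change g _ ∈ K
    convert this using 1
    simp only [g]
    module
  rcases le_total (p * t + (1 - p) * s) a with hle | hle
  · have h1 : p * t + (1 - p) * s ≤ s := hsmax ⟨hmid, by nlinarith, hle⟩
    nlinarith
  · have h1 : t ≤ p * t + (1 - p) * s := htmin ⟨hmid, hle, by nlinarith⟩
    nlinarith

end ClosedConvex

/-! ### Invariant sets of weak limits of factors -/

section Clopen

variable {Ω : Type*} [TopologicalSpace Ω] [CompactSpace Ω] [T2Space Ω] [TotallyDisconnectedSpace Ω]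
  [MeasurableSpace Ω] [BorelSpace Ω]

theorem exists_isClopen_measureReal_symmDiff_lt (ν : Measure Ω) [IsFiniteMeasure ν]
    [ν.WeaklyRegular] {A : Set Ω} (hA : MeasurableSet A) {ε : ℝ} (hε : 0 < ε) :
    ∃ D, IsClopen D ∧ ν.real (symmDiff A D) < ε := by
  have hε' : ENNReal.ofReal (ε / 2) ≠ 0 := by simpa using hε
  obtain ⟨F, hFA, hF, hF'⟩ := hA.exists_isClosed_sdiff_lt (measure_ne_top ν _) hε'
  obtain ⟨G, hGA, hG, hG'⟩ := hA.compl.exists_isClosed_sdiff_lt (measure_ne_top ν _) hε'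
  obtain ⟨D, hD, hFD, hDG⟩ := exists_clopen_of_closed_subset_open hF hG.isOpen_compl
    fun x hx hx' => hGA hx' (hFA hx)
  refine ⟨D, hD, ?_⟩
  have h1 : ν.real (A \ F) < ε / 2 := ENNReal.toReal_lt_of_lt_ofReal hF'
  have h2 : ν.real (Aᶜ \ G) < ε / 2 := ENNReal.toReal_lt_of_lt_ofReal hG'
  have h3 : symmDiff A D ⊆ (A \ F) ∪ (Aᶜ \ G) := by
    rintro x (⟨hx, hx'⟩ | ⟨hx, hx'⟩)
    · exact Or.inl ⟨hx, fun h => hx' (hFD h)⟩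
    · exact Or.inr ⟨hx', fun h => hDG hx h⟩
  linarith [measureReal_mono (μ := ν) h3, measureReal_union_le (μ := ν) (A \ F) (Aᶜ \ G)]

end Clopen

section InvariantMeasures

variable (Γ : Type*) {Ω : Type*} [Group Γ] [TopologicalSpace Ω] [MeasurableSpace Ω] [BorelSpace Ω]
  [MulAction Γ Ω] [ContinuousConstSMul Γ Ω] [HasOuterApproxClosed Ω]

theorem isClosed_invMeasures : IsClosed (invMeasures Γ Ω) := by
  have h : invMeasures Γ Ω = ⋂ γ : Γ, {ν | ν.map
      (continuous_const_smul γ).measurable.aemeasurable = ν} := by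
    ext ν
    simp only [mem_iInter]
    exact forall_congr' fun γ => ProbabilityMeasure.toMeasure_injective.eq_iff (a := ν.map
      (continuous_const_smul γ).measurable.aemeasurable)
  rw [h]
  exact isClosed_iInter fun γ => isClosed_eq
    (ProbabilityMeasure.continuous_map (continuous_const_smul γ)) continuous_id

end InvariantMeasures

section WeakClass

attribute [local instance] shiftMulAction continuousConstSMul_shift

variable {Γ : Type*} [Group Γ] [Countable Γ] {C : Type*} [TopologicalSpace C]
  [SecondCountableTopology C] [MeasurableSpace C] [BorelSpace C]
  {X : Type*} [MeasurableSpace X] [MulAction Γ X] [MeasurableConstSMul Γ X]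
  {μ : Measure X} [IsProbabilityMeasure μ]

theorem factorMeasure_mem_invMeasures [SMulInvariantMeasure Γ X μ] {φ : X → C}
    (hφ : Measurable φ) : factorMeasure μ hφ ∈ invMeasures Γ (Γ → C) := fun γ => by
  have hm := measurable_factorMap (Γ := Γ) hφ
  change (μ.map _).map _ = μ.map _
  have h1 : (fun y : Γ → C => γ • y) ∘ factorMap φ = factorMap φ ∘ (γ • ·) :=
    funext fun x => (factorMap_smul φ γ x).symm
  rw [Measure.map_map (measurable_const_smul γ) hm, h1,
    ← Measure.map_map hm (measurable_const_smul γ), (measurePreserving_smul γ μ).map_eq]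

variable [CompactSpace C] [T2Space C] in
theorem weakClass_subset_invMeasures [SMulInvariantMeasure Γ X μ] :
    weakClass Γ C μ ⊆ invMeasures Γ (Γ → C) := by
  refine closure_minimal (fun ν hν => ?_) (isClosed_invMeasures Γ)
  obtain ⟨φ, hφ, rfl⟩ := mem_factorMeasures_iff.1 hν
  exact factorMeasure_mem_invMeasures hφ

/-- A factor of an ergodic action is ergodic. -/
theorem ergodicSMul_factorMeasure [ErgodicSMul Γ X μ] {φ : X → C} (hφ : Measurable φ) :
    ErgodicSMul Γ (Γ → C) (factorMeasure (Γ := Γ) μ hφ : Measure (Γ → C)) := by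
  have hm := measurable_factorMap (Γ := Γ) hφ
  have := smulInvariantMeasure_of_mem (factorMeasure_mem_invMeasures (Γ := Γ) (μ := μ) hφ)
  refine ⟨fun {s} hs hinv => ?_⟩
  have h0 : Measure.QuasiMeasurePreserving (factorMap φ) μ
      (factorMeasure (Γ := Γ) μ hφ : Measure (Γ → C)) := ⟨hm, Measure.AbsolutelyContinuous.rfl⟩
  have h1 := ErgodicSMul.aeconst_of_forall_preimage_smul_ae_eq (G := Γ) (μ := μ)
    (s := factorMap φ ⁻¹' s) (hm hs) fun γ => by
      have h2 : (γ • ·) ⁻¹' (factorMap φ ⁻¹' s) = factorMap φ ⁻¹' ((γ • ·) ⁻¹' s) := by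
        ext x
        simp only [mem_preimage, factorMap_smul]
      rw [h2]
      exact h0.preimage_ae_eq (hinv γ)
  refine (eventuallyConst_set'.1 h1).elim (fun h => ?_) fun h => ?_
  · exact eventuallyConst_set'.2 (Or.inl (by
      have h2 := ae_eq_empty.1 h
      rw [← Measure.map_apply hm hs] at h2
      exact ae_eq_empty.2 h2))
  · exact eventuallyConst_set'.2 (Or.inr (by
      have h2 := ae_eq_univ.1 h
      rw [← preimage_compl, ← Measure.map_apply hm hs.compl] at h2
      exact ae_eq_univ.2 h2))

variable [CompactSpace C] [T2Space C] [TotallyDisconnectedSpace C]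

/-- An invariant set `A` of a weak limit `x` of factors comes from asymptotically invariant sets
`B k` in `X`: `A` is approximated by clopen sets, whose indicator functions are continuous, and
these are pulled back by factor maps. -/
theorem exists_isAsymptoticallyInvariant_of_mem_weakClass {x : ProbabilityMeasure (Γ → C)}
    (hx : x ∈ weakClass Γ C μ) {A : Set (Γ → C)} (hA : MeasurableSet A)
    (hinv : ∀ γ : Γ, (γ • ·) ⁻¹' A =ᵐ[(x : Measure (Γ → C))] A)
    [SMulInvariantMeasure Γ (Γ → C) (x : Measure (Γ → C))] :
    ∃ (B : ℕ → Set X) (φ : ℕ → X → C), IsAsymptoticallyInvariant Γ μ B ∧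
      (∀ k, Measurable (φ k)) ∧ ∀ f : (Γ → C) →ᵇ ℝ,
        Tendsto (fun k => ∫ z in B k, f (factorMap (φ k) z) ∂μ) atTop
          (𝓝 (∫ y in A, f y ∂(x : Measure (Γ → C)))) := by
  classical
  let ν : Measure (Γ → C) := x
  let d := TopologicalSpace.denseSeq ((Γ → C) →ᵇ ℝ)
  let T : Set ((ℕ → ℝ) × (Γ → ℝ)) := {q | ∃ (B : Set X) (φ : X → C), MeasurableSet B ∧
    Measurable φ ∧ q = (fun i => ∫ z in B, d i (factorMap φ z) ∂μ,
      fun γ => μ.real (symmDiff B ((fun z => γ • z) '' B)))}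
  have hshift : ∀ (γ : Γ) {D : Set (Γ → C)}, IsClopen D → IsClopen ((fun y => γ • y) '' D) :=
    fun γ D hD => by
      rw [image_smul_eq_preimage]
      exact hD.preimage (continuous_const_smul _)
  have hsymm : ∀ (γ : Γ) {D : Set (Γ → C)}, IsClopen D →
      IsClopen (symmDiff D ((fun y => γ • y) '' D)) := fun γ D hD =>
    (hD.diff (hshift γ hD)).union ((hshift γ hD).diff hD)
  have hind : ∀ (κ : ProbabilityMeasure (Γ → C)) {D : Set (Γ → C)} (hD : IsClopen D),
      evalInt (BoundedContinuousFunction.indicator D hD) κ = (κ : Measure (Γ → C)).real D :=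
    fun κ D hD => integral_indicator_one hD.1.measurableSet
  have hindmul : ∀ (κ : ProbabilityMeasure (Γ → C)) {D : Set (Γ → C)} (hD : IsClopen D)
      (f : (Γ → C) →ᵇ ℝ), evalInt (BoundedContinuousFunction.indicator D hD * f) κ =
        ∫ y in D, f y ∂(κ : Measure (Γ → C)) := fun κ D hD f => by
    rw [← integral_indicator hD.1.measurableSet]
    refine integral_congr_ae (ae_of_all _ fun y => ?_)
    by_cases hy : y ∈ D <;> simp [hy]
  -- A clopen set gives a continuous map on the space of measures, which sends factors into `T`.
  have hclo : ∀ D : Set (Γ → C), IsClopen D → ((fun i => ∫ y in D, d i y ∂ν,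
      fun γ => ν.real (symmDiff D ((fun y => γ • y) '' D))) : (ℕ → ℝ) × (Γ → ℝ)) ∈ closure T := by
    intro D hD
    let h : ProbabilityMeasure (Γ → C) → (ℕ → ℝ) × (Γ → ℝ) := fun κ =>
      (fun i => evalInt (BoundedContinuousFunction.indicator D hD * d i) κ,
        fun γ => evalInt (BoundedContinuousFunction.indicator _ (hsymm γ hD)) κ)
    have hh : Continuous h := (continuous_pi fun i => (evalInt _).continuous).prodMk
      (continuous_pi fun γ => (evalInt _).continuous)
    have hmaps : MapsTo h (factorMeasures Γ C μ) T := by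
      intro κ hκ
      obtain ⟨φ, hφ, rfl⟩ := mem_factorMeasures_iff.1 hκ
      have hm := measurable_factorMap (Γ := Γ) hφ
      refine ⟨factorMap φ ⁻¹' D, φ, hm hD.1.measurableSet, hφ, ?_⟩
      refine Prod.ext (funext fun i => ?_) (funext fun γ => ?_)
      · change evalInt (BoundedContinuousFunction.indicator D hD * d i) _ = _
        rw [hindmul]
        exact setIntegral_map hD.1.measurableSet
          (d i).continuous.measurable.aestronglyMeasurable hm.aemeasurable
      · change evalInt (BoundedContinuousFunction.indicator _ (hsymm γ hD)) _ = _
        rw [hind]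
        change (μ.map (factorMap φ)).real _ = _
        rw [map_measureReal_apply hm (hsymm γ hD).1.measurableSet, image_smul_eq_preimage,
          preimage_symmDiff]
        change _ = μ.real (symmDiff (factorMap φ ⁻¹' D) ((fun z => γ • z) '' (factorMap φ ⁻¹' D)))
        rw [image_smul_eq_preimage]
        congr 2
        ext z
        simp [factorMap_smul]
    have h1 := map_mem_closure hh hx hmaps
    convert h1 using 1
    exact Prod.ext (funext fun i => (hindmul _ _ _).symm) (funext fun γ => (hind _ _).symm)
  have hAγ : ∀ γ : Γ, ν.real (symmDiff A ((fun y => γ • y) '' A)) = 0 := fun γ => by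
    rw [image_smul_eq_preimage]
    rw [measureReal_def, measure_symmDiff_eq_zero_iff.2 (hinv γ⁻¹).symm, ENNReal.toReal_zero]
  choose D hD hDA using fun n : ℕ => exists_isClopen_measureReal_symmDiff_lt ν hA
    (Nat.one_div_pos_of_nat (n := n) (α := ℝ))
  have hDlim : Tendsto (fun n => ν.real (symmDiff A (D n))) atTop (𝓝 0) :=
    squeeze_zero (fun n => measureReal_nonneg) (fun n => (hDA n).le)
      tendsto_one_div_add_atTop_nhds_zero_nat
  have hq : ((fun i => ∫ y in A, d i y ∂ν, 0) : (ℕ → ℝ) × (Γ → ℝ)) ∈ closure T := by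
    refine isClosed_closure.mem_of_tendsto (b := atTop) (Tendsto.prodMk_nhds
      (tendsto_pi_nhds.2 fun i => ?_) (tendsto_pi_nhds.2 fun γ => ?_))
      (Eventually.of_forall fun n => hclo (D n) (hD n))
    · rw [tendsto_iff_norm_sub_tendsto_zero]
      refine squeeze_zero (fun n => norm_nonneg _) (fun n => ?_)
        (by simpa using hDlim.const_mul ‖d i‖)
      have hi : ∀ S : Set (Γ → C), IntegrableOn (d i) S ν := fun S =>
        ((d i).integrable ν).integrableOn
      have h1 := integral_inter_add_sdiff (hD n).1.measurableSet (hi A)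
      have h2 := integral_inter_add_sdiff hA (hi (D n))
      rw [inter_comm] at h2
      have h3 : ‖∫ y in A \ D n, d i y ∂ν‖ ≤ ‖d i‖ * ν.real (A \ D n) :=
        norm_setIntegral_le_of_norm_le_const (measure_lt_top _ _)
          fun y _ => (d i).norm_coe_le_norm y
      have h4 : ‖∫ y in D n \ A, d i y ∂ν‖ ≤ ‖d i‖ * ν.real (D n \ A) :=
        norm_setIntegral_le_of_norm_le_const (measure_lt_top _ _)
          fun y _ => (d i).norm_coe_le_norm y
      have h5 : ν.real (symmDiff A (D n)) = ν.real (A \ D n) + ν.real (D n \ A) :=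
        measureReal_union disjoint_sdiff_sdiff ((hD n).1.measurableSet.diff hA)
      rw [← h1, ← h2, h5, mul_add, add_sub_add_left_eq_sub]
      exact (norm_sub_le _ _).trans (by linarith)
    · refine squeeze_zero (fun n => measureReal_nonneg) (fun n => ?_)
        (by simpa using hDlim.const_mul 2)
      have hγD : ν.real (symmDiff ((fun y => γ • y) '' A) ((fun y => γ • y) '' D n)) =
          ν.real (symmDiff A (D n)) := by
        rw [← image_symmDiff (MulAction.injective γ), image_smul_eq_preimage,
          measureReal_def, measureReal_def, measure_preimage_smul]
      have h1 := measureReal_symmDiff_le (μ := ν) (s := D n) (t := A)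
        ((fun y => γ • y) '' D n)
      have h2 := measureReal_symmDiff_le (μ := ν) (s := A) (t := (fun y => γ • y) '' A)
        ((fun y => γ • y) '' D n)
      rw [symmDiff_comm (D n) A] at h1
      rw [hAγ, hγD] at h2
      linarith
  obtain ⟨q, hqT, hqlim⟩ := mem_closure_iff_seq_limit.1 hq
  choose B φ hB hφ hBq using hqT
  have hlim1 : ∀ i, Tendsto (fun k => ∫ z in B k, d i (factorMap (φ k) z) ∂μ) atTop
      (𝓝 (∫ y in A, d i y ∂ν)) := fun i => by
    have h1 := ((continuous_apply i).comp continuous_fst).continuousAt.tendsto.comp hqlim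
    exact h1.congr fun k => by simp only [Function.comp_apply, hBq]
  refine ⟨B, φ, ⟨hB, fun γ => ?_⟩, hφ, fun f => ?_⟩
  · have h1 := ((continuous_apply γ).comp continuous_snd).continuousAt.tendsto.comp hqlim
    exact h1.congr fun k => by simp only [Function.comp_apply, hBq]
  · refine Metric.tendsto_atTop.2 fun ε hε => ?_
    obtain ⟨i, hi⟩ := (TopologicalSpace.denseRange_denseSeq _).exists_dist_lt f
      (show 0 < ε / 3 by positivity)
    obtain ⟨N, hN⟩ := Metric.tendsto_atTop.1 (hlim1 i) (ε / 3) (by positivity)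
    refine ⟨N, fun k hk => ?_⟩
    have hdist : ∀ y, ‖f y - d i y‖ ≤ ε / 3 := fun y =>
      (BoundedContinuousFunction.dist_coe_le_dist y).trans hi.le
    have h1 : dist (∫ z in B k, f (factorMap (φ k) z) ∂μ)
        (∫ z in B k, d i (factorMap (φ k) z) ∂μ) ≤ ε / 3 := by
      rw [dist_eq_norm, ← integral_sub (integrable_comp_factorMap f (hφ k)).integrableOn
        (integrable_comp_factorMap (d i) (hφ k)).integrableOn]
      refine (norm_setIntegral_le_of_norm_le_const (measure_lt_top _ _)
        fun y _ => hdist _).trans ?_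
      exact mul_le_of_le_one_right (by positivity) measureReal_le_one
    have h2 : dist (∫ y in A, d i y ∂ν) (∫ y in A, f y ∂ν) ≤ ε / 3 := by
      rw [dist_comm, dist_eq_norm, ← integral_sub (f.integrable _) ((d i).integrable _)]
      refine (norm_setIntegral_le_of_norm_le_const (measure_lt_top _ _)
        fun y _ => hdist _).trans ?_
      exact mul_le_of_le_one_right (by positivity) measureReal_le_one
    have h3 := hN k hk
    have h4 := dist_triangle4 (∫ z in B k, f (factorMap (φ k) z) ∂μ)
      (∫ z in B k, d i (factorMap (φ k) z) ∂μ) (∫ y in A, d i y ∂ν) (∫ y in A, f y ∂ν)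
    linarith

/-- Conditioning a weak limit of factors of an ergodic action on an invariant set produces weak
limits of factors. -/
theorem cond_mem_weakClass [ErgodicSMul Γ X μ] {x : ProbabilityMeasure (Γ → C)}
    (hx : x ∈ weakClass Γ C μ) {A : Set (Γ → C)} (hA : MeasurableSet A)
    (hinv : ∀ γ : Γ, (γ • ·) ⁻¹' A =ᵐ[(x : Measure (Γ → C))] A)
    {η : ProbabilityMeasure (Γ → C)} (hA0 : (x : Measure (Γ → C)) A ≠ 0)
    (hη : (η : Measure (Γ → C)) = ProbabilityTheory.cond (x : Measure (Γ → C)) A) :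
    η ∈ weakClass Γ C μ := by
  have := smulInvariantMeasure_of_mem (weakClass_subset_invMeasures hx)
  obtain ⟨B, φ, hB, hφ, hlim⟩ := exists_isAsymptoticallyInvariant_of_mem_weakClass hx hA hinv
  set p := (x : Measure (Γ → C)).real A with hp
  have hp0 : 0 < p := by
    rw [hp, measureReal_def]
    exact ENNReal.toReal_pos hA0 (measure_ne_top _ _)
  have hBp : Tendsto (fun k => μ.real (B k)) atTop (𝓝 p) := by
    simpa [measureReal_def, hp] using hlim 1
  have h1 : ∀ f : (Γ → C) →ᵇ ℝ, ∫ y in A, f y ∂(x : Measure (Γ → C)) =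
      p * ∫ y, f y ∂(η : Measure (Γ → C)) := fun f => by
    rw [hη]
    simp only [ProbabilityTheory.cond, integral_smul_measure, ENNReal.toReal_inv, smul_eq_mul]
    rw [← measureReal_def, mul_inv_cancel_left₀ hp0.ne']
  simp_rw [h1] at hlim
  have h2 := smul_add_smul_mem_of_isAsymptoticallyInvariant hB hBp hφ hlim
  have h3 : IsClosed (toDual '' weakClass Γ C μ) :=
    isClosedEmbedding_probToDual.isClosedMap _ isClosed_closure
  obtain ⟨η', h4, h5⟩ := h3.mem_of_smul_add_smul_mem hp0 measureReal_le_one h2 ⟨_, x, hx, rfl⟩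
  exact probToDual_injective h5 ▸ h4

end WeakClass

/-! ### Strong ergodicity -/

section StrongErgodicity

variable {Γ : Type*} [Group Γ] {X : Type*} [MeasurableSpace X] [MulAction Γ X]
  {μ : Measure X} [IsProbabilityMeasure μ]

/-- The measures of asymptotically invariant sets in a strongly ergodic action accumulate only at
`0` and `1`. -/
theorem IsStronglyErgodic.eq_zero_or_eq_one (h : IsStronglyErgodic Γ μ) {B : ℕ → Set X}
    (hB : IsAsymptoticallyInvariant Γ μ B) {p : ℝ}
    (hp : Tendsto (fun k => μ.real (B k)) atTop (𝓝 p)) : p = 0 ∨ p = 1 := by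
  have hp0 : 0 ≤ p := ge_of_tendsto' hp fun k => measureReal_nonneg
  have hp1 : p ≤ 1 := le_of_tendsto' hp fun k => measureReal_le_one
  have h1 := (hp.mul (hp.const_sub 1)).limsup_eq
  have h2 : p * (1 - p) ≤ 0 := not_lt.1 fun h2 => h ⟨B, hB, h1 ▸ h2⟩
  rcases hp0.eq_or_lt with h0 | h0
  · exact Or.inl h0.symm
  · exact Or.inr (le_antisymm hp1 (sub_nonpos.1 (nonpos_of_mul_nonpos_right h2 h0)))

theorem eventuallyConst_of_measureReal {Y : Type*} [MeasurableSpace Y] {ν : Measure Y}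
    [IsProbabilityMeasure ν] {s : Set Y} (hs : MeasurableSet s)
    (h : ν.real s = 0 ∨ ν.real s = 1) : EventuallyConst s (ae ν) := by
  refine eventuallyConst_set'.2 (h.imp (fun h => ?_) fun h => ?_)
  · exact ae_eq_empty.2 ((measureReal_eq_zero_iff).1 h)
  · refine ae_eq_univ.2 ((prob_compl_eq_zero_iff hs).2 ?_)
    rw [← ENNReal.toReal_eq_one_iff]
    exact h

attribute [local instance] shiftMulAction continuousConstSMul_shift

variable [Countable Γ] [MeasurableConstSMul Γ X] [SMulInvariantMeasure Γ X μ] {C : Type*} [TopologicalSpace C]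
  [SecondCountableTopology C] [MeasurableSpace C] [BorelSpace C]
  [CompactSpace C] [T2Space C]

/-- All weak limits of factors of a strongly ergodic action are ergodic. -/
theorem IsStronglyErgodic.ergodicSMul_of_mem_weakClass [TotallyDisconnectedSpace C]
    (h : IsStronglyErgodic Γ μ)
    {x : ProbabilityMeasure (Γ → C)} (hx : x ∈ weakClass Γ C μ) :
    ErgodicSMul Γ (Γ → C) (x : Measure (Γ → C)) := by
  have := smulInvariantMeasure_of_mem (weakClass_subset_invMeasures hx)
  refine ⟨fun {s} hs hinv => eventuallyConst_of_measureReal hs ?_⟩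
  obtain ⟨B, φ, hB, hφ, hlim⟩ := exists_isAsymptoticallyInvariant_of_mem_weakClass hx hs hinv
  exact h.eq_zero_or_eq_one hB (by simpa [measureReal_def] using hlim 1)

end StrongErgodicity

section NotStronglyErgodic

attribute [local instance] shiftMulAction continuousConstSMul_shift

variable {Γ : Type*} [Group Γ] {X : Type*} [MeasurableSpace X] [MulAction Γ X]
  {μ : Measure X} [IsProbabilityMeasure μ]

/-- An action that is not strongly ergodic has asymptotically invariant sets whose measures converge
to a number strictly between `0` and `1`. -/
theorem exists_isAsymptoticallyInvariant_of_not_isStronglyErgodic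
    (h : ¬ IsStronglyErgodic Γ μ) :
    ∃ (B : ℕ → Set X) (p : ℝ), IsAsymptoticallyInvariant Γ μ B ∧ 0 < p ∧ p < 1 ∧
      Tendsto (fun k => μ.real (B k)) atTop (𝓝 p) := by
  obtain ⟨B, ⟨hBm, hBi⟩, hlim⟩ := not_not.1 h
  obtain ⟨c, hc, hc'⟩ := exists_between hlim
  have hfreq : ∃ᶠ i in atTop, c < μ.real (B i) * (1 - μ.real (B i)) :=
    frequently_lt_of_lt_limsup (isCoboundedUnder_le_of_le atTop (x := 0) fun i =>
      mul_nonneg measureReal_nonneg (sub_nonneg.2 measureReal_le_one)) hc'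
  obtain ⟨a, ha, hac⟩ := extraction_of_frequently_atTop hfreq
  obtain ⟨p, -, b, hb, hp⟩ := isCompact_Icc.tendsto_subseq
    (x := fun k => μ.real (B (a k))) (s := Icc 0 1)
    fun k => ⟨measureReal_nonneg, measureReal_le_one⟩
  have hab : Tendsto (fun k => a (b k)) atTop atTop := ha.tendsto_atTop.comp hb.tendsto_atTop
  have hpc : c ≤ p * (1 - p) := ge_of_tendsto' (hp.mul (hp.const_sub 1)) fun k => (hac (b k)).le
  have h0 : 0 ≤ p := ge_of_tendsto' hp fun k => measureReal_nonneg
  exact ⟨fun k => B (a (b k)), p, ⟨fun k => hBm _, fun γ => (hBi γ).comp hab⟩, by nlinarith,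
    by nlinarith, hp⟩

variable [Countable Γ] [MeasurableConstSMul Γ X] {C : Type*} [TopologicalSpace C]
  [SecondCountableTopology C] [MeasurableSpace C] [BorelSpace C] [CompactSpace C] [T2Space C]

theorem convex_weakClass_of_not_isStronglyErgodic [ErgodicSMul Γ X μ]
    (h : ¬ IsStronglyErgodic Γ μ) : Convex ℝ (toDual '' weakClass Γ C μ) := by
  obtain ⟨B, p, hB, hp0, hp1, hp⟩ := exists_isAsymptoticallyInvariant_of_not_isStronglyErgodic h
  have hcl : toDual '' weakClass Γ C μ = closure (toDual '' factorMeasures Γ C μ) :=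
    (isClosedEmbedding_probToDual.closure_image_eq _).symm
  have hW : IsClosed (toDual '' weakClass Γ C μ) := hcl ▸ isClosed_closure
  refine hW.convex_of_smul_add_smul_mem hp0 hp1 fun y hy z hz => ?_
  rw [hcl] at hy
  have hcont : Continuous fun y : WeakDual ℝ ((Γ → C) →ᵇ ℝ) => p • y + (1 - p) • z := by
    fun_prop
  rw [← hW.closure_eq]
  refine map_mem_closure (f := fun y : WeakDual ℝ ((Γ → C) →ᵇ ℝ) => p • y + (1 - p) • z)
    hcont hy ?_
  rintro _ ⟨η, hη, rfl⟩
  obtain ⟨φ, hφ, rfl⟩ := mem_factorMeasures_iff.1 hη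
  refine smul_add_smul_mem_of_isAsymptoticallyInvariant hB hp (fun _ => hφ) (fun f => ?_) z hz
  rw [integral_factorMeasure]
  have iφ := integrable_comp_factorMap (μ := μ) f hφ
  exact tendsto_setIntegral_of_isAsymptoticallyInvariant hB hp
    (MemLp.of_bound iφ.aestronglyMeasurable ‖f‖ (ae_of_all _ fun x => f.norm_coe_le_norm _))

end NotStronglyErgodic

section Nonextreme

attribute [local instance] shiftMulAction continuousConstSMul_shift

variable {Γ : Type*} [Group Γ] [Countable Γ] {C : Type*} [TopologicalSpace C]
  [SecondCountableTopology C] [MeasurableSpace C] [BorelSpace C]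
  {X : Type*} [MeasurableSpace X] [MulAction Γ X] [MeasurableConstSMul Γ X]
  {μ : Measure X} [IsProbabilityMeasure μ]

theorem toDual_factorMeasure_const_apply (c : C) (f : (Γ → C) →ᵇ ℝ) :
    toDual (factorMeasure μ (measurable_const (a := c)) : ProbabilityMeasure (Γ → C)) f =
      f fun _ => c := by
  change ∫ y, f y ∂(factorMeasure (Γ := Γ) μ (measurable_const (a := c)) : Measure (Γ → C)) = _
  rw [integral_factorMeasure]
  change ∫ _, f (fun _ => c) ∂μ = _
  simp

variable [CompactSpace C] [T2Space C] in
theorem toDual_factorMeasure_const_ne {c d : C} (hcd : c ≠ d) :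
    toDual (factorMeasure μ (measurable_const (a := c)) : ProbabilityMeasure (Γ → C)) ≠
      toDual (factorMeasure μ (measurable_const (a := d)) : ProbabilityMeasure (Γ → C)) := by
  intro h
  have hne : (fun _ => c : Γ → C) ≠ fun _ => d := fun h => hcd (congrFun h 1)
  let := TopologicalSpace.metrizableSpaceMetric (Γ → C)
  obtain ⟨f, hf0, hf1, -⟩ := exists_continuous_zero_one_of_isClosed
    (isClosed_singleton (x := (fun _ => c : Γ → C))) (isClosed_singleton (x := fun _ => d))
    (disjoint_singleton.2 hne)
  have h1 := DFunLike.congr_fun h (BoundedContinuousFunction.mkOfCompact f)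
  rw [toDual_factorMeasure_const_apply, toDual_factorMeasure_const_apply] at h1
  have h2 : f (fun _ => c) = f fun _ => d := h1
  rw [hf0 rfl, hf1 rfl] at h2
  exact zero_ne_one h2

/-- If the action is not ergodic, then some factor is a nontrivial convex combination of two fixed
points. -/
theorem exists_openSegment_of_not_ergodicSMul [SMulInvariantMeasure Γ X μ]
    (h : ¬ ErgodicSMul Γ X μ) (c d : C) : ∃ ν ∈ factorMeasures Γ C μ,
      toDual ν ∈ openSegment ℝ
        (toDual (factorMeasure μ (measurable_const (a := c)) : ProbabilityMeasure (Γ → C)))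
        (toDual (factorMeasure μ (measurable_const (a := d)) : ProbabilityMeasure (Γ → C))) := by
  classical
  obtain ⟨A, hA, hinv, hconst⟩ : ∃ A : Set X, MeasurableSet A ∧
      (∀ γ : Γ, (γ • ·) ⁻¹' A =ᵐ[μ] A) ∧ ¬ EventuallyConst A (ae μ) := by
    by_contra! hcon
    exact h ⟨fun hs hinv => hcon _ hs hinv⟩
  have hA0 : μ.real A ≠ 0 := fun h0 => hconst (eventuallyConst_of_measureReal hA (Or.inl h0))
  have hA1 : μ.real A ≠ 1 := fun h0 => hconst (eventuallyConst_of_measureReal hA (Or.inr h0))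
  have hφ : Measurable (A.piecewise (fun _ => c) fun _ => d) :=
    measurable_const.piecewise hA measurable_const
  refine ⟨factorMeasure μ hφ, factorMeasure_mem hφ, μ.real A, 1 - μ.real A,
    lt_of_le_of_ne measureReal_nonneg hA0.symm, sub_pos.2 (lt_of_le_of_ne measureReal_le_one hA1),
    by ring, DFunLike.ext _ _ fun f => ?_⟩
  change μ.real A * toDual (factorMeasure μ (measurable_const (a := c))) f +
    (1 - μ.real A) * toDual (factorMeasure μ (measurable_const (a := d))) f =
    ∫ y, f y ∂(factorMeasure (Γ := Γ) μ hφ : Measure (Γ → C))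
  rw [toDual_factorMeasure_const_apply, toDual_factorMeasure_const_apply, integral_factorMeasure,
    ← integral_add_compl hA (integrable_comp_factorMap f hφ)]
  have hall : ∀ᵐ x ∂μ, ∀ γ : Γ, (γ • x ∈ A ↔ x ∈ A) :=
    ae_all_iff.2 fun γ => (hinv γ).mem_iff
  have h1 : ∫ x in A, f (factorMap (A.piecewise (fun _ => c) fun _ => d) x) ∂μ =
      ∫ x in A, f (fun _ => c) ∂μ := setIntegral_congr_ae hA (by
    filter_upwards [hall] with x hx hxA
    congr 1
    exact funext fun γ => piecewise_eq_of_mem _ _ _ ((hx _).2 hxA))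
  have h2 : ∫ x in Aᶜ, f (factorMap (A.piecewise (fun _ => c) fun _ => d) x) ∂μ =
      ∫ x in Aᶜ, f (fun _ => d) ∂μ := setIntegral_congr_ae hA.compl (by
    filter_upwards [hall] with x hx hxA
    congr 1
    exact funext fun γ => piecewise_eq_of_notMem _ _ _ fun h => hxA ((hx _).1 h))
  rw [h1, h2, setIntegral_const, setIntegral_const, probReal_compl_eq_one_sub hA, smul_eq_mul,
    smul_eq_mul]

end Nonextreme

/-! ### Stable weak limits of factors -/

section StableWeakClass

/-- The trivial action of `Γ` on the unit interval. -/
@[reducible]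
def trivialMulAction (Γ : Type*) [Group Γ] : MulAction Γ unitInterval where
  smul _ t := t
  one_smul _ := rfl
  mul_smul _ _ _ := rfl

variable {Γ : Type*} [Group Γ] {C : Type*} [MeasurableSpace C]
  {X : Type*} [MeasurableSpace X] [MulAction Γ X]

attribute [local instance] shiftMulAction continuousConstSMul_shift
attribute [local instance] trivialMulAction

variable (Γ X) in
theorem measurableConstSMul_prod_trivial [MeasurableConstSMul Γ X] :
    MeasurableConstSMul Γ (X × unitInterval) :=
  ⟨fun γ => ((measurable_const_smul γ).comp measurable_fst).prodMk measurable_snd⟩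

attribute [local instance] measurableConstSMul_prod_trivial

variable [MeasurableConstSMul Γ X] {μ : Measure X} [IsProbabilityMeasure μ]

variable (Γ μ) in
theorem smulInvariantMeasure_prod_trivial [SMulInvariantMeasure Γ X μ] :
    SMulInvariantMeasure Γ (X × unitInterval) (μ.prod volume) :=
  ⟨fun γ _ hs => ((measurePreserving_smul γ μ).prod (MeasurePreserving.id _)).measure_preimage
    hs.nullMeasurableSet⟩

attribute [local instance] smulInvariantMeasure_prod_trivial

variable [Countable Γ] [TopologicalSpace C] [SecondCountableTopology C] [BorelSpace C]

/-- A factor of `X × [0,1]` is a mixture of factors of `X`. -/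
theorem integral_factorMeasure_prod {φ : X × unitInterval → C} (hφ : Measurable φ)
    (f : (Γ → C) →ᵇ ℝ) :
    ∫ y, f y ∂(factorMeasure (Γ := Γ) (μ.prod (volume : Measure unitInterval)) hφ :
      Measure (Γ → C)) =
      ∫ s : unitInterval, ∫ x, f (factorMap (fun x => φ (x, s)) x) ∂μ := by
  rw [integral_factorMeasure, integral_prod_symm _ (integrable_comp_factorMap f hφ)]
  rfl

variable [CompactSpace C] [T2Space C]

theorem factorMeasures_subset_stableWeakClass :
    factorMeasures Γ C μ ⊆ stableWeakClass Γ C μ := by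
  intro ν hν
  obtain ⟨φ, hφ, rfl⟩ := mem_factorMeasures_iff.1 hν
  have hφ' : Measurable fun z : X × unitInterval => φ z.1 := hφ.comp measurable_fst
  have h1 : (factorMeasure μ hφ : ProbabilityMeasure (Γ → C)) = factorMeasure (μ.prod volume) hφ' :=
    probToDual_injective (DFunLike.ext _ _ fun f => by
      change ∫ y, f y ∂(factorMeasure (Γ := Γ) μ hφ : Measure (Γ → C)) =
        ∫ y, f y ∂(factorMeasure (Γ := Γ) (μ.prod (volume : Measure unitInterval)) hφ' :
          Measure (Γ → C))
      rw [integral_factorMeasure, integral_factorMeasure_prod]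
      simp)
  rw [h1]
  exact subset_closure (factorMeasure_mem hφ')

theorem weakClass_subset_stableWeakClass : weakClass Γ C μ ⊆ stableWeakClass Γ C μ :=
  closure_minimal factorMeasures_subset_stableWeakClass isClosed_closure

theorem stableWeakClass_subset_invMeasures [SMulInvariantMeasure Γ X μ] :
    stableWeakClass Γ C μ ⊆ invMeasures Γ (Γ → C) :=
  weakClass_subset_invMeasures (μ := μ.prod (volume : Measure unitInterval))

/-- The factors of `X × [0,1]` form a convex set, because `[0,1]` is isomorphic to its product with
a two-point probability space, which serves to choose one of two given factors. -/
theorem convex_stableWeakClass : Convex ℝ (toDual '' stableWeakClass Γ C μ) := by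
  classical
  have hcl : toDual '' stableWeakClass Γ C μ =
      closure (toDual '' factorMeasures Γ C (μ.prod (volume : Measure unitInterval))) :=
    (isClosedEmbedding_probToDual.closure_image_eq _).symm
  suffices h : Convex ℝ (toDual '' factorMeasures Γ C (μ.prod (volume : Measure unitInterval))) by
    rw [hcl]
    exact Convex.closure (𝕜 := ℝ) (E := WeakDual ℝ ((Γ → C) →ᵇ ℝ)) h
  rintro _ ⟨ν, hν, rfl⟩ _ ⟨ν', hν', rfl⟩ a b ha hb hab
  obtain ⟨φ, hφ, rfl⟩ := mem_factorMeasures_iff.1 hν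
  obtain ⟨φ', hφ', rfl⟩ := mem_factorMeasures_iff.1 hν'
  let β : Measure Bool := ENNReal.ofReal a • Measure.dirac true + ENNReal.ofReal b • Measure.dirac false
  have hβ : IsProbabilityMeasure β := ⟨by
    simp [β, ← ENNReal.ofReal_add ha hb, hab]⟩
  obtain ⟨g, hg, hgmap⟩ := Measure.exists_measurable_map_eq
    ((volume : Measure unitInterval).prod β)
  let Ψ : X × unitInterval → C := fun z =>
    if (g z.2).2 = true then φ (z.1, (g z.2).1) else φ' (z.1, (g z.2).1)
  have hg1 : Measurable fun z : X × unitInterval => (z.1, (g z.2).1) :=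
    measurable_fst.prodMk (measurable_fst.comp (hg.comp measurable_snd))
  have hΨ : Measurable Ψ := Measurable.ite
    ((measurable_snd.comp (hg.comp measurable_snd)) (measurableSet_singleton true))
    (hφ.comp hg1) (hφ'.comp hg1)
  refine ⟨_, factorMeasure_mem hΨ, DFunLike.ext _ _ fun f => ?_⟩
  change ∫ y, f y ∂(factorMeasure (Γ := Γ) (μ.prod (volume : Measure unitInterval)) hΨ :
      Measure (Γ → C)) =
    a * (∫ y, f y ∂(factorMeasure (Γ := Γ) (μ.prod (volume : Measure unitInterval)) hφ :
      Measure (Γ → C))) +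
    b * ∫ y, f y ∂(factorMeasure (Γ := Γ) (μ.prod (volume : Measure unitInterval)) hφ' :
      Measure (Γ → C))
  simp only [integral_factorMeasure_prod]
  let H : (X × unitInterval → C) → unitInterval → ℝ := fun φ s =>
    ∫ x, f (factorMap (fun x => φ (x, s)) x) ∂μ
  have hH : ∀ {φ : X × unitInterval → C}, Measurable φ → StronglyMeasurable (H φ) := fun {φ} h =>
    StronglyMeasurable.integral_prod_left'
      (f := fun z => f (factorMap φ z))
      (f.continuous.measurable.comp (measurable_factorMap h)).stronglyMeasurable
  have hHb : ∀ (φ : X × unitInterval → C) s, ‖H φ s‖ ≤ ‖f‖ := fun φ s => by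
    refine (norm_integral_le_of_norm_le_const (ae_of_all _ fun x => f.norm_coe_le_norm _)).trans ?_
    simp
  let H2 : unitInterval × Bool → ℝ := fun q => if q.2 = true then H φ q.1 else H φ' q.1
  have hH2 : StronglyMeasurable H2 := StronglyMeasurable.ite
    (measurable_snd (measurableSet_singleton true)) ((hH hφ).comp_measurable measurable_fst)
    ((hH hφ').comp_measurable measurable_fst)
  have hH2i : Integrable H2 ((volume : Measure unitInterval).prod β) :=
    Integrable.of_bound hH2.aestronglyMeasurable ‖f‖ (ae_of_all _ fun q => by
      simp only [H2]; split_ifs <;> exact hHb _ _)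
  have h1 : ∀ s, ∫ x, f (factorMap (fun x => Ψ (x, s)) x) ∂μ = H2 (g s) := fun s => by
    simp only [H2, H, Ψ]
    split_ifs <;> rfl
  have hint : ∀ k : Bool → ℝ, ∫ t, k t ∂β = a * k true + b * k false := fun k => by
    have i1 : ∀ c : ENNReal, c ≠ ⊤ → ∀ t : Bool, Integrable k (c • Measure.dirac t) :=
      fun c hc t => (integrable_dirac (by simp)).smul_measure hc
    rw [integral_add_measure (i1 _ ENNReal.ofReal_ne_top _) (i1 _ ENNReal.ofReal_ne_top _)]
    simp [integral_smul_measure, ENNReal.toReal_ofReal, ha, hb]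
  simp_rw [h1]
  rw [← integral_map (f := H2) hg.aemeasurable (hgmap ▸ hH2.aestronglyMeasurable), hgmap,
    integral_prod _ hH2i]
  simp_rw [hint]
  have hi : ∀ {φ : X × unitInterval → C}, Measurable φ → Integrable (H φ) volume := fun h =>
    Integrable.of_bound (hH h).aestronglyMeasurable ‖f‖ (ae_of_all _ (hHb _))
  simp only [H2, if_true, Bool.false_eq_true, if_false]
  rw [integral_add ((hi hφ).const_mul a) ((hi hφ').const_mul b), integral_const_mul,
    integral_const_mul]

theorem exists_isBarycenter_of_mem_factorMeasures_prod {ν : ProbabilityMeasure (Γ → C)}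
    (hν : ν ∈ factorMeasures Γ C (μ.prod (volume : Measure unitInterval))) :
    ∃ m : ProbabilityMeasure (ProbabilityMeasure (Γ → C)),
      (m : Measure (ProbabilityMeasure (Γ → C))) (weakClass Γ C μ) = 1 ∧
      IsBarycenter (m : Measure (ProbabilityMeasure (Γ → C))) ν := by
  obtain ⟨φ, hφ, rfl⟩ := mem_factorMeasures_iff.1 hν
  have hs : ∀ s, Measurable fun x => φ (x, s) := fun s => hφ.comp measurable_prodMk_right
  let J : unitInterval → ProbabilityMeasure (Γ → C) := fun s => factorMeasure μ (hs s)
  have hJ : Measurable J := Measurable.subtype_mk (Measure.measurable_of_measurable_coe _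
    fun S hS => by
      have h1 : ∀ s, (J s : Measure (Γ → C)) S =
          μ ((fun x => (x, s)) ⁻¹' (factorMap φ ⁻¹' S)) := fun s =>
        Measure.map_apply (measurable_factorMap (hs s)) hS
      change Measurable fun s => (J s : Measure (Γ → C)) S
      simp_rw [h1]
      exact measurable_measure_prodMk_right (measurable_factorMap hφ hS))
  refine ⟨⟨volume.map J, Measure.isProbabilityMeasure_map hJ.aemeasurable⟩, ?_, fun f => ?_⟩
  · change volume.map J _ = 1
    have hW : IsClosed (weakClass Γ C μ) := isClosed_closure
    rw [Measure.map_apply hJ hW.measurableSet]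
    have : J ⁻¹' weakClass Γ C μ = univ :=
      eq_univ_of_forall fun s => subset_closure (factorMeasure_mem (hs s))
    rw [this, measure_univ]
  · change ∫ e, evalInt f e ∂(volume.map J) = _
    rw [integral_map hJ.aemeasurable (evalInt f).continuous.measurable.aestronglyMeasurable,
      integral_factorMeasure_prod]
    exact integral_congr_ae (ae_of_all _ fun s => integral_factorMeasure (hs s) f)

/-- Every point of `stableWeakClass` is the barycenter of a measure on `weakClass`. -/
theorem exists_isBarycenter_of_mem_stableWeakClass {x : ProbabilityMeasure (Γ → C)}
    (hx : x ∈ stableWeakClass Γ C μ) :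
    ∃ m : ProbabilityMeasure (ProbabilityMeasure (Γ → C)),
      (∀ᵐ e ∂(m : Measure (ProbabilityMeasure (Γ → C))), e ∈ weakClass Γ C μ) ∧
      IsBarycenter (m : Measure (ProbabilityMeasure (Γ → C))) x := by
  have hW : IsClosed (weakClass Γ C μ) := isClosed_closure
  let Q : Set (ProbabilityMeasure (ProbabilityMeasure (Γ → C)) × ProbabilityMeasure (Γ → C)) :=
    {q | (q.1 : Measure (ProbabilityMeasure (Γ → C))) (weakClass Γ C μ) = 1 ∧
      IsBarycenter (q.1 : Measure (ProbabilityMeasure (Γ → C))) q.2}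
  have hQ : IsClosed Q := by
    refine IsClosed.and ?_ ?_
    · have h1 : IsClosed {m : ProbabilityMeasure (ProbabilityMeasure (Γ → C)) |
          (m : Measure (ProbabilityMeasure (Γ → C))) (weakClass Γ C μ) = 1} := by
        refine isSeqClosed_iff_isClosed.1 fun m m' hm hlim => le_antisymm prob_le_one ?_
        have h2 := ProbabilityMeasure.limsup_measure_closed_le_of_tendsto hlim hW
        have h3 : ∀ n, (m n : Measure (ProbabilityMeasure (Γ → C))) (weakClass Γ C μ) = 1 := hm
        simpa [h3] using h2
      exact h1.preimage continuous_fst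
    · simp only [IsBarycenter, ofPred_forall]
      exact isClosed_iInter fun f => isClosed_eq
        ((evalInt (evalInt f)).continuous.comp continuous_fst)
        ((evalInt f).continuous.comp continuous_snd)
  have hcl : IsClosed (Prod.snd '' Q) := (hQ.isCompact.image continuous_snd).isClosed
  have hsub : stableWeakClass Γ C μ ⊆ Prod.snd '' Q := closure_minimal (fun ν hν => by
    obtain ⟨m, h1, h2⟩ := exists_isBarycenter_of_mem_factorMeasures_prod hν
    exact ⟨(m, ν), ⟨h1, h2⟩, rfl⟩) hcl
  obtain ⟨⟨m, x'⟩, ⟨h1, h2⟩, rfl⟩ := hsub hx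
  exact ⟨m, (prob_compl_eq_zero_iff hW.measurableSet).2 h1, h2⟩

theorem stableWeakClass_eq_weakClass_of_convex (h : Convex ℝ (toDual '' weakClass Γ C μ)) :
    stableWeakClass Γ C μ = weakClass Γ C μ := by
  refine Subset.antisymm (fun x hx => ?_) weakClass_subset_stableWeakClass
  obtain ⟨m, hm, hbar⟩ := exists_isBarycenter_of_mem_stableWeakClass hx
  obtain ⟨y, hy, hyx⟩ := mem_of_isBarycenter h
    (isClosedEmbedding_probToDual.isClosedMap _ isClosed_closure) _
    (hm.mono fun e he => ⟨e, he, rfl⟩) hbar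
  exact probToDual_injective hyx ▸ hy

end StableWeakClass

/-! ### Representing measures on extreme points -/

section Transport

variable {E : Type*} [AddCommGroup E] [Module ℝ E] [TopologicalSpace E]
  {P : Type*} [TopologicalSpace P] [MeasurableSpace P] [BorelSpace P]

/-- If `K` is a subset of the image of an embedding `j : P → E`, then measures on the extreme points
of `K` correspond to measures on `P`. So a point that is represented by a measure `m` on `P` that is
unique in a suitable class is uniquely represented by a measure on the extreme points. -/
theorem existsUnique_representsOnExtremePoints {j : P → E} (hj : IsEmbedding j) {K : Set E}
    (hK : K ⊆ range j) {x : E} {m : Measure P} [IsProbabilityMeasure m]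
    (hm : ∀ u : E →L[ℝ] ℝ, ∫ e, u (j e) ∂m = u x) (hmext : ∀ᵐ e ∂m, j e ∈ K.extremePoints ℝ)
    {G : Set P} (hG : MeasurableSet G) (hKG : ∀ e, j e ∈ K.extremePoints ℝ → e ∈ G)
    (huniq : ∀ m' : Measure P, IsProbabilityMeasure m' →
      (∀ u : E →L[ℝ] ℝ, ∫ e, u (j e) ∂m' = u x) → (∀ᵐ e ∂m', e ∈ G) → m' = m) :
    ∃! m', RepresentsOnExtremePoints K x m' := by
  let : MeasurableSpace (K.extremePoints ℝ) := borel (K.extremePoints ℝ)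
  have : BorelSpace (K.extremePoints ℝ) := ⟨rfl⟩
  refine existsUnique_of_exists_of_unique ?_ ?_
  · -- Transport `m`, restricted to a measurable set `t` of full measure, to the extreme points.
    obtain ⟨t, htE, ht, htm⟩ : ∃ t : Set P, (∀ e ∈ t, j e ∈ K.extremePoints ℝ) ∧
        MeasurableSet t ∧ ∀ᵐ e ∂m, e ∈ t := by
      obtain ⟨s, hs, hsm, hs0⟩ := exists_measurable_superset_of_null (ae_iff.1 hmext)
      exact ⟨sᶜ, fun e he => by_contra fun h => he (hs h), hsm.compl,
        measure_eq_zero_iff_ae_notMem.1 hs0⟩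
    let r : t → K.extremePoints ℝ := fun e => ⟨j e, htE _ e.2⟩
    have hr : Continuous r := (hj.continuous.comp continuous_subtype_val).subtype_mk _
    have htuniv : m t = 1 := (prob_compl_eq_zero_iff ht).1 htm
    have hprob : IsProbabilityMeasure (m.comap ((↑) : t → P)) := ⟨by
      rw [(MeasurableEmbedding.subtype_coe ht).comap_apply, image_univ, Subtype.range_coe, htuniv]⟩
    refine ⟨(m.comap (↑)).map r, Measure.isProbabilityMeasure_map hr.measurable.aemeasurable,
      fun u => ?_⟩
    have hu : Continuous fun e : K.extremePoints ℝ => u (e : E) :=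
      u.continuous.comp continuous_subtype_val
    rw [integral_map hr.measurable.aemeasurable hu.measurable.aestronglyMeasurable, ← hm u,
      integral_subtype_comap ht (fun e => u (j e)), Measure.restrict_eq_self_of_ae_mem htm]
  · have hmem : ∀ e : K.extremePoints ℝ, ∃ p, j p = (e : E) := fun e => hK e.2.1
    choose ι hι using hmem
    have hcomp : j ∘ ι = ((↑) : K.extremePoints ℝ → E) := funext hι
    have hind : IsInducing ι := by
      rw [← hj.isInducing.of_comp_iff, hcomp]
      exact IsInducing.subtypeVal
    have hιm := hind.continuous.measurable
    have key : ∀ m' : Measure (K.extremePoints ℝ), RepresentsOnExtremePoints K x m' →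
        m'.map ι = m := by
      rintro m' ⟨hp, hrep⟩
      refine huniq _ (Measure.isProbabilityMeasure_map hιm.aemeasurable) (fun u => ?_)
        ((ae_map_iff hιm.aemeasurable hG).2 (ae_of_all _ fun e => hKG _ (by rw [hι]; exact e.2)))
      rw [integral_map (f := fun e => u (j e)) hιm.aemeasurable
        (u.continuous.comp hj.continuous).measurable.aestronglyMeasurable]
      simp_rw [hι]
      exact hrep u
    intro m₁ m₂ h₁ h₂
    refine Measure.ext fun s hs => ?_
    have hs' : @MeasurableSet _ (MeasurableSpace.comap ι inferInstance) s := by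
      have h3 : borel (K.extremePoints ℝ) = MeasurableSpace.comap ι (borel P) := by
        rw [hind.eq_induced, borel_comap]
      rw [BorelSpace.measurable_eq (α := P), ← h3]
      exact hs
    obtain ⟨t, ht, rfl⟩ := hs'
    rw [← Measure.map_apply hιm ht, key m₁ h₁, ← key m₂ h₂, Measure.map_apply hιm ht]

end Transport

section Simplex

variable (Γ : Type*) {Ω : Type*} [Group Γ] [TopologicalSpace Ω] [MeasurableSpace Ω] [BorelSpace Ω]
  [MulAction Γ Ω] [ContinuousConstSMul Γ Ω] [Countable Γ] [CompactSpace Ω]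
  [TopologicalSpace.MetrizableSpace Ω]

variable (Ω) in
/-- The measures `e` such that the averages of a countable dense set of functions converge
to constants in `L²(e)`. On invariant measures this amounts to ergodicity, but it is visibly
a measurable condition on `e`. -/
def tendstoAvgSet : Set (ProbabilityMeasure Ω) :=
  {e | ∀ i, Tendsto (fun n => ∫ y, (avgFun Γ n (TopologicalSpace.denseSeq (Ω →ᵇ ℝ) i) y -
    ∫ z, TopologicalSpace.denseSeq (Ω →ᵇ ℝ) i z ∂(e : Measure Ω)) ^ 2 ∂(e : Measure Ω)) atTop
      (𝓝 0)}

theorem measurableSet_tendstoAvgSet : MeasurableSet (tendstoAvgSet Γ Ω) := by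
  simp only [tendstoAvgSet, ofPred_forall]
  refine MeasurableSet.iInter fun i => measurableSet_tendsto (𝓝 0) fun n => ?_
  set f := TopologicalSpace.denseSeq (Ω →ᵇ ℝ) i
  have h : ∀ e : ProbabilityMeasure Ω, ∫ y, (avgFun Γ n f y -
      ∫ z, f z ∂(e : Measure Ω)) ^ 2 ∂(e : Measure Ω) = evalInt (avgFun Γ n f ^ 2) e -
        (2 * evalInt f e * evalInt (avgFun Γ n f) e - evalInt f e ^ 2) := fun e => by
    set c := ∫ z, f z ∂(e : Measure Ω) with hc
    have i1 : Integrable (fun y => avgFun Γ n f y ^ 2) (e : Measure Ω) :=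
      (avgFun Γ n f ^ 2).integrable _
    have i3 : Integrable (fun y => 2 * c * avgFun Γ n f y - c ^ 2) (e : Measure Ω) :=
      (((avgFun Γ n f).integrable _).const_mul _).sub (integrable_const _)
    have i2 : Integrable (fun y => 2 * c * avgFun Γ n f y) (e : Measure Ω) :=
      ((avgFun Γ n f).integrable _).const_mul _
    have h2 : ∀ y, (avgFun Γ n f y - c) ^ 2 =
        avgFun Γ n f y ^ 2 - (2 * c * avgFun Γ n f y - c ^ 2) := fun y => by ring
    simp_rw [h2]
    rw [integral_sub i1 i3, integral_sub i2 (integrable_const _),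
      integral_const_mul]
    simp only [integral_const, probReal_univ, one_smul, evalInt_apply, ← hc]
    rfl
  simp_rw [h]
  have hm : ∀ g : Ω →ᵇ ℝ, Measurable fun e => evalInt g e := fun g =>
    (evalInt g).continuous.measurable
  exact (hm _).sub ((((hm _).const_mul 2).mul (hm _)).sub ((hm _).pow_const 2))

theorem mem_extremePoints_of_mem_tendstoAvgSet {e : ProbabilityMeasure Ω}
    (he : e ∈ invMeasures Γ Ω) (h : e ∈ tendstoAvgSet Γ Ω) :
    toDual e ∈ (toDual '' invMeasures Γ Ω).extremePoints ℝ :=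
  mem_extremePoints_of_tendsto Γ he (TopologicalSpace.denseRange_denseSeq _) (by
    rintro _ ⟨i, rfl⟩
    exact h i)

variable {Γ}

/-- Let `S` be a closed set of invariant measures all of whose extreme points are ergodic. Then
representing measures on the extreme points are unique, by the uniqueness of the ergodic
decomposition. -/
theorem existsUnique_representsOnExtremePoints_toDual {S : Set (ProbabilityMeasure Ω)}
    (hS : IsClosed S) (hSinv : S ⊆ invMeasures Γ Ω)
    (herg : ∀ e ∈ S, toDual e ∈ (toDual '' S).extremePoints ℝ → ErgodicSMul Γ Ω (e : Measure Ω))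
    {x : ProbabilityMeasure Ω} {m : Measure (ProbabilityMeasure Ω)} [IsProbabilityMeasure m]
    (hm : IsBarycenter m x) (hmext : ∀ᵐ e ∂m, toDual e ∈ (toDual '' S).extremePoints ℝ) :
    ∃! m', RepresentsOnExtremePoints (toDual '' S) (toDual x) m' := by
  have hmS : ∀ e, toDual e ∈ (toDual '' S).extremePoints ℝ → e ∈ S := fun e he => by
    obtain ⟨e', h1, h2⟩ := he.1
    exact probToDual_injective h2 ▸ h1
  refine existsUnique_representsOnExtremePoints (m := m) (G := S ∩ tendstoAvgSet Γ Ω)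
    isClosedEmbedding_probToDual.isEmbedding (image_subset_range _ _) (fun u => ?_) hmext
    (hS.measurableSet.inter (measurableSet_tendstoAvgSet Γ)) (fun e he => ?_)
    fun m' hprob hbar hm'G => ?_
  · obtain ⟨f, hf⟩ := WeakDual.exists_eq_eval u
    simp_rw [hf]
    exact hm f
  · have := herg e (hmS e he) he
    exact ⟨hmS e he, fun i => tendsto_avgFun_of_ergodic Γ (e : Measure Ω) _⟩
  · refine eq_of_isBarycenter_of_ergodic Γ (x := x) (fun f => ?_) hm ?_
      (hmext.mono fun e he => herg e (hmS e he) he)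
    · let u : WeakDual ℝ (Ω →ᵇ ℝ) →L[ℝ] ℝ :=
        { toFun := fun φ => φ f
          map_add' := fun _ _ => rfl
          map_smul' := fun _ _ => rfl
          cont := WeakDual.eval_continuous f }
      exact hbar u
    · filter_upwards [hm'G] with e he
      exact herg e he.1 (inter_extremePoints_subset_extremePoints_of_subset
        (image_mono hSinv) ⟨⟨e, he.1, rfl⟩,
          mem_extremePoints_of_mem_tendstoAvgSet Γ (hSinv he.1) he.2⟩)

end Simplex

/-! ### The simplex of stable weak limits of factors -/

section Subsimplex

variable {Γ : Type*} {Ω : Type*} [Group Γ] [TopologicalSpace Ω] [MeasurableSpace Ω] [BorelSpace Ω]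
  [MulAction Γ Ω] [ContinuousConstSMul Γ Ω] [Countable Γ] [CompactSpace Ω]
  [TopologicalSpace.MetrizableSpace Ω]

theorem isSubsimplex_toDual {S : Set (ProbabilityMeasure Ω)} (hne : S.Nonempty)
    (hS : IsClosed S) (hconv : Convex ℝ (toDual '' S)) (hSinv : S ⊆ invMeasures Γ Ω)
    (herg : ∀ e ∈ S, toDual e ∈ (toDual '' S).extremePoints ℝ → ErgodicSMul Γ Ω (e : Measure Ω))
    (hrep : ∀ x ∈ S, ∃ m : ProbabilityMeasure (ProbabilityMeasure Ω),
      IsBarycenter (m : Measure (ProbabilityMeasure Ω)) x ∧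
      ∀ᵐ e ∂(m : Measure (ProbabilityMeasure Ω)), toDual e ∈ (toDual '' S).extremePoints ℝ) :
    IsSubsimplex (toDual '' S) (toDual '' invMeasures Γ Ω) := by
  have hcl := isClosedEmbedding_probToDual.isClosedMap _ hS
  refine ⟨image_mono hSinv, hcl, hconv, ?_, hne.image _, hS.isCompact.image continuous_probToDual,
    hconv, ?_⟩
  · intro e he
    obtain ⟨e', h1, rfl⟩ := he.1
    have := herg e' h1 he
    exact mem_extremePoints_of_ergodic Γ e'
  · rintro _ ⟨x, hx, rfl⟩
    obtain ⟨m, h1, h2⟩ := hrep x hx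
    exact existsUnique_representsOnExtremePoints_toDual hS hSinv herg h1 h2

end Subsimplex

section Conclusion

attribute [local instance] shiftMulAction continuousConstSMul_shift

variable {Γ : Type*} [Group Γ] [Countable Γ] {C : Type*} [TopologicalSpace C]
  [SecondCountableTopology C] [MeasurableSpace C] [BorelSpace C]
  {X : Type*} [MeasurableSpace X] [MulAction Γ X] [MeasurableConstSMul Γ X]
  {μ : Measure X} [IsProbabilityMeasure μ]

theorem nonempty_weakClass [Nonempty C] : (weakClass Γ C μ).Nonempty :=
  ⟨_, subset_closure (factorMeasure_mem (measurable_const (a := Classical.arbitrary C)))⟩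

/-- An ergodic measure in a set of invariant measures is an extreme point. -/
theorem mem_extremePoints_of_ergodicSMul {S : Set (ProbabilityMeasure (Γ → C))}
    (hS : S ⊆ invMeasures Γ (Γ → C)) {e : ProbabilityMeasure (Γ → C)} (he : e ∈ S)
    [ErgodicSMul Γ (Γ → C) (e : Measure (Γ → C))] :
    toDual e ∈ (toDual '' S).extremePoints ℝ :=
  inter_extremePoints_subset_extremePoints_of_subset (image_mono hS)
    ⟨⟨e, he, rfl⟩, mem_extremePoints_of_ergodic Γ e⟩

variable [CompactSpace C] [T2Space C]

/-- For a strongly ergodic action, the weak limits of factors are ergodic, and conversely an extreme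
point of the stable weak limits, being a barycenter of weak limits, is a weak limit. -/
theorem IsStronglyErgodic.extremePoints_stableWeakClass [TotallyDisconnectedSpace C]
    [SMulInvariantMeasure Γ X μ] (h : IsStronglyErgodic Γ μ) :
    (toDual '' stableWeakClass Γ C μ).extremePoints ℝ = toDual '' weakClass Γ C μ := by
  refine Subset.antisymm (fun e he => ?_) ?_
  · obtain ⟨x, hx, rfl⟩ := he.1
    obtain ⟨m, hm, hbar⟩ := exists_isBarycenter_of_mem_stableWeakClass hx
    exact ⟨x, mem_of_mem_extremePoints convex_stableWeakClass
      (isClosedEmbedding_probToDual.isClosedMap _ isClosed_closure) isClosed_closure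
      (image_mono weakClass_subset_stableWeakClass) _ hm hbar he, rfl⟩
  · rintro _ ⟨x, hx, rfl⟩
    have := h.ergodicSMul_of_mem_weakClass hx
    exact mem_extremePoints_of_ergodicSMul stableWeakClass_subset_invMeasures
      (weakClass_subset_stableWeakClass hx)

theorem IsStronglyErgodic.isSubsimplex [TotallyDisconnectedSpace C] [Nonempty C]
    [SMulInvariantMeasure Γ X μ] (h : IsStronglyErgodic Γ μ) :
    IsSubsimplex (toDual '' stableWeakClass Γ C μ) (toDual '' invMeasures Γ (Γ → C)) := by
  refine isSubsimplex_toDual (nonempty_weakClass.mono weakClass_subset_stableWeakClass)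
    isClosed_closure convex_stableWeakClass stableWeakClass_subset_invMeasures
    (fun e _ he => ?_) fun x hx => ?_
  · rw [h.extremePoints_stableWeakClass] at he
    obtain ⟨e', h1, h2⟩ := he
    exact probToDual_injective h2 ▸ h.ergodicSMul_of_mem_weakClass h1
  · obtain ⟨m, hm, hbar⟩ := exists_isBarycenter_of_mem_stableWeakClass hx
    refine ⟨m, hbar, ?_⟩
    rw [h.extremePoints_stableWeakClass]
    exact hm.mono fun e he => ⟨e, he, rfl⟩

/-- If `A` is an invariant set for an extreme point `x` of the weak limits of factors of an ergodic
action, then `x` is a convex combination of its conditional measures on `A` and the complement,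
which are weak limits of factors as well. -/
theorem ergodicSMul_of_mem_extremePoints [TotallyDisconnectedSpace C] [ErgodicSMul Γ X μ]
    {x : ProbabilityMeasure (Γ → C)} (hx : x ∈ weakClass Γ C μ)
    (hext : toDual x ∈ (toDual '' weakClass Γ C μ).extremePoints ℝ) :
    ErgodicSMul Γ (Γ → C) (x : Measure (Γ → C)) := by
  have := smulInvariantMeasure_of_mem (weakClass_subset_invMeasures hx)
  refine ⟨fun {A} hA hinv => eventuallyConst_of_measureReal hA ?_⟩
  by_contra! hcon
  set ν := (x : Measure (Γ → C))
  have hAc : ν.real Aᶜ ≠ 0 := by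
    rw [probReal_compl_eq_one_sub hA, sub_ne_zero]
    exact hcon.2.symm
  have h0 : ∀ {D : Set (Γ → C)}, ν.real D ≠ 0 → ν D ≠ 0 := fun h h' => h (by
    rw [measureReal_def, h', ENNReal.toReal_zero])
  have h1 := cond_mem_weakClass hx hA hinv
    (η := ⟨_, ProbabilityTheory.cond_isProbabilityMeasure (h0 hcon.1)⟩) (h0 hcon.1) rfl
  have h2 := cond_mem_weakClass hx hA.compl (fun γ => (hinv γ).compl)
    (η := ⟨_, ProbabilityTheory.cond_isProbabilityMeasure (h0 hAc)⟩) (h0 hAc) rfl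
  have hseg := (mem_extremePoints.1 hext).2 _ ⟨_, h1, rfl⟩ _ ⟨_, h2, rfl⟩ ⟨ν.real A, ν.real Aᶜ,
    lt_of_le_of_ne measureReal_nonneg hcon.1.symm, lt_of_le_of_ne measureReal_nonneg hAc.symm,
    probReal_add_probReal_compl hA, DFunLike.ext _ _ fun f => ?_⟩
  · have h3 := congrArg (fun κ : ProbabilityMeasure (Γ → C) => (κ : Measure (Γ → C)) Aᶜ)
      (probToDual_injective hseg.1)
    have h4 : ProbabilityTheory.cond ν A Aᶜ = 0 := by
      rw [ProbabilityTheory.cond_apply hA, inter_compl_self, measure_empty, mul_zero]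
    exact h0 hAc (h3.symm.trans h4)
  · change ν.real A * (∫ y, f y ∂(ProbabilityTheory.cond ν A)) +
      ν.real Aᶜ * (∫ y, f y ∂(ProbabilityTheory.cond ν Aᶜ)) = ∫ y, f y ∂ν
    simp only [ProbabilityTheory.cond, integral_smul_measure, ENNReal.toReal_inv, smul_eq_mul]
    rw [← measureReal_def, ← measureReal_def, mul_inv_cancel_left₀ hcon.1,
      mul_inv_cancel_left₀ hAc, integral_add_compl hA (f.integrable ν)]

/-- For an ergodic action that is not strongly ergodic, the weak limits of factors form a simplex:
representing measures are given by the ergodic decomposition. -/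
theorem isSubsimplex_weakClass_of_not_isStronglyErgodic [TotallyDisconnectedSpace C] [Nonempty C]
    [ErgodicSMul Γ X μ] (h : ¬ IsStronglyErgodic Γ μ) :
    IsSubsimplex (toDual '' weakClass Γ C μ) (toDual '' invMeasures Γ (Γ → C)) := by
  have hconv := convex_weakClass_of_not_isStronglyErgodic (C := C) h
  refine isSubsimplex_toDual nonempty_weakClass isClosed_closure hconv
    weakClass_subset_invMeasures (fun e he hext => ergodicSMul_of_mem_extremePoints he hext)
    fun x hx => ?_
  obtain ⟨m, hbar, hmW, hm⟩ := exists_ergodic_decomposition Γ isClosed_closure hconv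
    weakClass_subset_invMeasures (weakClass_subset_invMeasures hx)
    fun A hA hinv η hA0 hη => cond_mem_weakClass hx hA hinv hA0 hη
  refine ⟨m, hbar, ?_⟩
  filter_upwards [hmW, hm] with e heW he
  exact inter_extremePoints_subset_extremePoints_of_subset (image_mono
    weakClass_subset_invMeasures) ⟨⟨e, heW, rfl⟩, mem_extremePoints_of_mem_tendstoAvgSet Γ
      (weakClass_subset_invMeasures heW) fun i => he _ ⟨i, rfl⟩⟩

/-- If the weak limits of factors are the extreme points of the stable ones, then they contain
no convex combinations of each other. This fails for actions that are not ergodic, where a factor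
may be a mixture of two fixed points, and for ergodic actions that are not strongly ergodic, where
the set of weak limits is convex. -/
theorem isStronglyErgodic_of_eq_extremePoints [Nontrivial C] [SMulInvariantMeasure Γ X μ]
    (h : toDual '' weakClass Γ C μ = (toDual '' stableWeakClass Γ C μ).extremePoints ℝ) :
    IsStronglyErgodic Γ μ := by
  obtain ⟨c, d, hcd⟩ := exists_pair_ne C
  have hmem : ∀ c : C, toDual (factorMeasure μ (measurable_const (a := c)) :
      ProbabilityMeasure (Γ → C)) ∈ toDual '' weakClass Γ C μ := fun c =>
    ⟨_, subset_closure (factorMeasure_mem _), rfl⟩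
  have hseg : ∀ y ∈ toDual '' weakClass Γ C μ, y ∉ openSegment ℝ
      (toDual (factorMeasure μ (measurable_const (a := c)) : ProbabilityMeasure (Γ → C)))
      (toDual (factorMeasure μ (measurable_const (a := d)) : ProbabilityMeasure (Γ → C))) := by
    intro y hy hy'
    rw [h] at hy
    have h1 := (mem_extremePoints.1 hy).2 _ (image_mono weakClass_subset_stableWeakClass (hmem c))
      _ (image_mono weakClass_subset_stableWeakClass (hmem d)) hy'
    exact toDual_factorMeasure_const_ne hcd (h1.1.trans h1.2.symm)
  by_cases herg : ErgodicSMul Γ X μ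
  · by_contra hcon
    have hconv := convex_weakClass_of_not_isStronglyErgodic (C := C) hcon
    have hmid : ∀ y z : WeakDual ℝ ((Γ → C) →ᵇ ℝ),
        (1 / 2 : ℝ) • y + (1 / 2 : ℝ) • z ∈ openSegment ℝ y z := fun y z =>
      ⟨1 / 2, 1 / 2, by norm_num, by norm_num, by norm_num, rfl⟩
    exact hseg _ (hconv.openSegment_subset (hmem c) (hmem d) (hmid _ _)) (hmid _ _)
  · obtain ⟨ν, hν, hν'⟩ := exists_openSegment_of_not_ergodicSMul herg c d
    exact absurd hν' (hseg _ ⟨ν, subset_closure hν, rfl⟩)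

theorem isPoulsenSimplex_weakClass [TotallyDisconnectedSpace C] [Nontrivial C]
    [ErgodicSMul Γ X μ] (h : ¬ IsStronglyErgodic Γ μ) :
    IsPoulsenSimplex (toDual '' weakClass Γ C μ) := by
  refine ⟨(isSubsimplex_weakClass_of_not_isStronglyErgodic h).2.2.2.2, ?_, ?_, ?_⟩
  · exact (isClosedEmbedding_probToDual.isEmbedding.homeomorphImage
      (weakClass Γ C μ)).symm.isEmbedding.metrizableSpace
  · obtain ⟨c, d, hcd⟩ := exists_pair_ne C
    exact ⟨_, ⟨_, subset_closure (factorMeasure_mem (measurable_const (a := c))), rfl⟩,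
      _, ⟨_, subset_closure (factorMeasure_mem (measurable_const (a := d))), rfl⟩,
      toDual_factorMeasure_const_ne hcd⟩
  · refine (image_closure_subset_closure_image continuous_probToDual).trans (closure_mono ?_)
    rintro _ ⟨ν, hν, rfl⟩
    obtain ⟨φ, hφ, rfl⟩ := mem_factorMeasures_iff.1 hν
    have := ergodicSMul_factorMeasure (Γ := Γ) (μ := μ) hφ
    exact mem_extremePoints_of_ergodicSMul weakClass_subset_invMeasures (subset_closure hν)

end Conclusion

theorem mainTheorem4 {Γ : Type*} [Group Γ] [Countable Γ]
    {C : Type*} [TopologicalSpace C] [SecondCountableTopology C] [MeasurableSpace C]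
    [BorelSpace C] (hC : Nonempty (C ≃ₜ cantorSet))
    {X : Type*} [MeasurableSpace X] [StandardBorelSpace X]
    (μ : Measure X) [IsProbabilityMeasure μ]
    [MulAction Γ X] [MeasurableConstSMul Γ X] [SMulInvariantMeasure Γ X μ] :
    (ErgodicSMul Γ X μ →
      IsSubsimplex (toDual '' stableWeakClass Γ C μ) (toDual '' invariantProb Γ C)) ∧
    (IsStronglyErgodic Γ μ ↔
      toDual '' weakClass Γ C μ = (toDual '' stableWeakClass Γ C μ).extremePoints ℝ) ∧
    (IsStronglyErgodic Γ μ → IsBauerSimplex (toDual '' stableWeakClass Γ C μ)) ∧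
    (ErgodicSMul Γ X μ → ¬ IsStronglyErgodic Γ μ →
      stableWeakClass Γ C μ = weakClass Γ C μ ∧
        IsPoulsenSimplex (toDual '' stableWeakClass Γ C μ)) := by
  obtain ⟨e⟩ := hC
  let e' : C ≃ₜ (ℕ → Bool) := e.trans cantorSetHomeomorphNatToBool
  have : CompactSpace C := e'.symm.compactSpace
  have : T2Space C := e'.symm.t2Space
  have : TotallyDisconnectedSpace C := e'.symm.totallyDisconnectedSpace
  have : Nontrivial C := e'.toEquiv.nontrivial
  have hstable : ErgodicSMul Γ X μ → ¬ IsStronglyErgodic Γ μ →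
      stableWeakClass Γ C μ = weakClass Γ C μ := fun _ h =>
    stableWeakClass_eq_weakClass_of_convex (convex_weakClass_of_not_isStronglyErgodic h)
  refine ⟨fun herg => ?_, ⟨fun h => h.extremePoints_stableWeakClass.symm,
    isStronglyErgodic_of_eq_extremePoints⟩, fun h => ⟨h.isSubsimplex.2.2.2.2, ?_⟩,
    fun herg h => ⟨hstable herg h, ?_⟩⟩
  · by_cases h : IsStronglyErgodic Γ μ
    · exact h.isSubsimplex
    · rw [hstable herg h]
      exact isSubsimplex_weakClass_of_not_isStronglyErgodic h
  · rw [h.extremePoints_stableWeakClass]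
    exact isClosedEmbedding_probToDual.isClosedMap _ isClosed_closure
  · rw [hstable herg h]
    exact isPoulsenSimplex_weakClass h
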